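/- Let $k$ be an algebraically closed field of characteristic $0$, let $\lambda\in k$ with $\lambda^3\neq 1$, and let $E\subset\mathbb P^2$ be the elliptic curve $x^3+y^3+z^3=3\lambda xyz$, with zero element $o_E=(1:-1:0)$ and $j$-invariant $j(E)=27\lambda^3(\lambda^3+8)^3/(\lambda^3-1)^3$. The sum of $(a:b:c)$ and $(\alpha:\beta:\gamma)$ in $E$ is $(ac\beta^2-b^2\alpha\gamma:bc\alpha^2-a^2\beta\gamma:ab\gamma^2-c^2\alpha\beta)$ or $(ab\alpha^2-c^2\beta\gamma:ac\gamma^2-b^2\alpha\beta:bc\beta^2-a^2\alpha\gamma)$, whichever is not the zero vector (where both are nonzero, they define the same point). Put $E[n]=\{p\in E: np=o_E\}$ and let $T[3]$ be the group of translations of $E$ by the points of $E[3]$. Let $V$ be the vector space with basis $x,y,z$, and identify $\mathbb P^2$ with $\mathbb P(V^*)$ by means of the dual basis. For $p=(a:b:c)\in E\setminus E[3]$ let $$w_p=a(xyz+yzx+zxy)+b(xzy+yxz+zyx)+c(x^3+y^3+z^3)\in V^{\otimes 3},$$ $\mathrm{Aut}(w_p)=\{\theta\in \mathrm{GL}(V):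 \theta^{\otimes 3}(w_p)=\mu w_p \text{ for some }\mu\in k^\times\}$ and $\mathrm{PAut}(w_p)=\mathrm{Aut}(w_p)/k^\times \mathrm{id}_V$. Let $\varepsilon$ be a primitive third root of unity, and put $\tau_1(a:b:c)=(b:a:c)$, $\tau_2(a:b:c)=(b:a:c\varepsilon)$ (an automorphism of $E$ if $\lambda=0$), and $\tau_3(a:b:c)=(a\varepsilon^2+b\varepsilon+c:a\varepsilon+b\varepsilon^2+c:a+b+c)$ (an automorphism of $E$ if $\lambda=1+\sqrt3$). Let $p\in E\setminus E[3]$. In each of the cases (1)–(3) below, the maps $\theta\mapsto\overline{\theta^*}|_E$, with $\theta\in\mathrm{Aut}(w_p)$, are automorphisms of $E$, and they identify $\mathrm{PAut}(w_p)$ (through $\theta\mapsto\overline{(\theta^{-1})^*}|_E$, an injective group homomorphism) with the following group of automorphisms of $E$; the semidirect products are internal. (1) If $j(E)\neq 0,12^3$, then $\mathrm{PAut}(w_p)=T[3]$ if $p\notin E[2]$, and $\mathrm{PAut}(w_p)=T[3]\rtimes\langle\tau_1\rangle$ if $p\in E[2]$. (2) If $\lambda=0$, then $\mathrm{PAut}(w_p)=T[3]$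 if $p\notin E[2]$, and $\mathrm{PAut}(w_p)=T[3]\rtimes\langle\tau_2^3\rangle$ if $p\in E[2]$. (3) If $\lambda=1+\sqrt3$, where $\sqrt3$ is either square root of $3$ in $k$, then $\mathrm{PAut}(w_p)=T[3]$ if $p\notin E[2]$, $\mathrm{PAut}(w_p)=T[3]\rtimes\langle\tau_3^2\rangle$ if $p\in E[2]\setminus\{o_E,(1:1:\lambda)\}$, and $\mathrm{PAut}(w_p)=T[3]\rtimes\langle\tau_3\rangle$ if $p=(1:1:\lambda)$. -/

import Mathlib

open scoped TensorProduct LinearAlgebra.Projectivization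

noncomputable section

namespace Sklyanin

/-- A three-dimensional vector space with a fixed basis. -/
abbrev V3 (k : Type*) : Type _ := Fin 3 → k

variable {k : Type*} [Field k]

/-! ### Potentials and their automorphism groups -/

/-- The space of potentials `V ⊗ V ⊗ V`, where `V` has the basis `x, y, z`. -/
abbrev Potential (k : Type*) [Field k] : Type _ := (V3 k ⊗[k] V3 k) ⊗[k] V3 k

/-- The basis vector `x` of `V`. -/
def bx : V3 k := Pi.single 0 1

/-- The basis vector `y` of `V`. -/
def byy : V3 k := Pi.single 1 1

/-- The basis vector `z` of `V`. -/
def bz : V3 k := Pi.single 2 1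

/-- The monomial `u v w = u ⊗ v ⊗ w`. -/
def mono3 (u v w : V3 k) : Potential k := (u ⊗ₜ[k] v) ⊗ₜ[k] w

/-- The linear map `θ ⊗ θ ⊗ θ` on potentials. -/
def tensorCube (θ : V3 k ≃ₗ[k] V3 k) : Potential k →ₗ[k] Potential k :=
  TensorProduct.map (TensorProduct.map (θ : V3 k →ₗ[k] V3 k) (θ : V3 k →ₗ[k] V3 k))
    (θ : V3 k →ₗ[k] V3 k)

theorem tensorCube_one (w : Potential k) :
    tensorCube (1 : V3 k ≃ₗ[k] V3 k) w = w := by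
  have h : ((1 : V3 k ≃ₗ[k] V3 k) : V3 k →ₗ[k] V3 k) = LinearMap.id := rfl
  rw [tensorCube, h, TensorProduct.map_id, TensorProduct.map_id, LinearMap.id_apply]

theorem tensorCube_mul (θ η : V3 k ≃ₗ[k] V3 k) (w : Potential k) :
    tensorCube (θ * η) w = tensorCube θ (tensorCube η w) := by
  have h : ((θ * η : V3 k ≃ₗ[k] V3 k) : V3 k →ₗ[k] V3 k)
      = (θ : V3 k →ₗ[k] V3 k) ∘ₗ (η : V3 k →ₗ[k] V3 k) := rfl
  rw [tensorCube, h, TensorProduct.map_comp, TensorProduct.map_comp]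
  rfl

/-- `Aut (w)`: all `θ ∈ GL(V)` such that `θ ⊗ θ ⊗ θ` multiplies `w` by a nonzero scalar. -/
def Aut (w : Potential k) : Subgroup (V3 k ≃ₗ[k] V3 k) where
  carrier := {θ | ∃ c : k, c ≠ 0 ∧ tensorCube θ w = c • w}
  one_mem' := ⟨1, one_ne_zero, by rw [tensorCube_one, one_smul]⟩
  mul_mem' := by
    rintro θ η ⟨c, hc, h⟩ ⟨d, hd, h'⟩
    refine ⟨d * c, mul_ne_zero hd hc, ?_⟩
    rw [tensorCube_mul, h', map_smul, h, smul_smul]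
  inv_mem' := by
    rintro θ ⟨c, hc, h⟩
    refine ⟨c⁻¹, inv_ne_zero hc, ?_⟩
    have h2 : tensorCube θ⁻¹ (tensorCube θ w) = w := by
      rw [← tensorCube_mul, inv_mul_cancel, tensorCube_one]
    rw [h, map_smul] at h2
    rw [← h2, smul_smul, inv_mul_cancel₀ hc, one_smul, h2]

/-- The group `k^× id_V` of scalar automorphisms of `V`. -/
def scalars (k : Type*) [Field k] : Subgroup (V3 k ≃ₗ[k] V3 k) :=
  (DistribMulAction.toModuleAut k (V3 k) : kˣ →* (V3 k ≃ₗ[k] V3 k)).range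

theorem scalars_le_Aut (w : Potential k) : scalars k ≤ Aut w := by
  rintro _ ⟨a, rfl⟩
  refine ⟨(a : k) ^ 3, pow_ne_zero _ a.ne_zero, ?_⟩
  have h : ((DistribMulAction.toModuleAut k (V3 k) a : V3 k ≃ₗ[k] V3 k) : V3 k →ₗ[k] V3 k)
      = (a : k) • LinearMap.id := by
    ext; rfl
  rw [tensorCube, h]
  simp only [TensorProduct.map_smul_left, TensorProduct.map_smul_right, TensorProduct.map_id,
    LinearMap.smul_apply, LinearMap.id_apply, smul_smul]
  congr 1
  ring

instance scalars_normal (w : Potential k) : ((scalars k).subgroupOf (Aut w)).Normal := by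
  refine ⟨?_⟩
  rintro ⟨_, hw⟩ ⟨a, rfl⟩ ⟨θ, hθ⟩
  refine ⟨a, ?_⟩
  ext1 v
  change a • v = θ (a • θ⁻¹ v)
  have h : θ (θ⁻¹ v) = v := by
    rw [← LinearEquiv.mul_apply, mul_inv_cancel, LinearEquiv.coe_one, id_eq]
  have h2 : θ ((a : k) • θ⁻¹ v) = (a : k) • v := by rw [map_smul, h]
  exact h2.symm

/-- `PAut (w) = Aut (w) / k^× id_V`. -/
abbrev PAut (w : Potential k) : Type _ := Aut w ⧸ (scalars k).subgroupOf (Aut w)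

/-- The Sklyanin potential
`a (xyz + yzx + zxy) + b (xzy + yxz + zyx) + c (x³ + y³ + z³)`. -/
def potential (a b c : k) : Potential k :=
  a • (mono3 bx byy bz + mono3 byy bz bx + mono3 bz bx byy)
    + b • (mono3 bx bz byy + mono3 byy bx bz + mono3 bz byy bx)
    + c • (mono3 bx bx bx + mono3 byy byy byy + mono3 bz bz bz)

/-! ### The projective plane of `V*` -/

/-- The dual map `θ^* : V* → V*` in the coordinates of the dual basis: a linear functional
`f ∈ V*` has the coordinates `(f x, f y, f z)`. -/
def dualCoord (θ : V3 k ≃ₗ[k] V3 k) : V3 k ≃ₗ[k] V3 k :=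
  ((Pi.basisFun k (Fin 3)).toDualEquiv.trans θ.dualMap).trans
    (Pi.basisFun k (Fin 3)).toDualEquiv.symm

/-! ### Elliptic curves in Hesse form -/

/-- The cubic form `x³ + y³ + z³ - 3 λ x y z`. -/
def hesseForm (lam : k) (v : V3 k) : k :=
  v 0 ^ 3 + v 1 ^ 3 + v 2 ^ 3 - 3 * lam * v 0 * v 1 * v 2

/-- The plane curve `x³ + y³ + z³ = 3 λ x y z` in `ℙ²`. -/
abbrev HesseCurve (lam : k) : Type _ := {P : ℙ k (V3 k) // hesseForm lam P.rep = 0}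

theorem hesseForm_smul (lam c : k) (v : V3 k) :
    hesseForm lam (c • v) = c ^ 3 * hesseForm lam v := by
  simp only [hesseForm, Pi.smul_apply, smul_eq_mul]
  ring

theorem hesseForm_mk (lam : k) (v : V3 k) (hv : v ≠ 0) :
    hesseForm lam (Projectivization.mk k v hv).rep = 0 ↔ hesseForm lam v = 0 := by
  obtain ⟨c, hc⟩ := Projectivization.exists_smul_eq_mk_rep k v hv
  rw [← hc, Units.smul_def, hesseForm_smul, mul_eq_zero]
  simp

/-- The point of the curve with the given homogeneous coordinates. -/
def HesseCurve.mk {lam : k} (v : V3 k) (hv : v ≠ 0) (h : hesseForm lam v = 0) :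
    HesseCurve lam :=
  ⟨Projectivization.mk k v hv, (hesseForm_mk lam v hv).2 h⟩

/-- The `j`-invariant of `x³ + y³ + z³ = 3 λ x y z`. -/
def jInv (lam : k) : k := 27 * lam ^ 3 * (lam ^ 3 + 8) ^ 3 / (lam ^ 3 - 1) ^ 3

/-- The zero element `(1 : -1 : 0)`. -/
instance (lam : k) : Zero (HesseCurve lam) :=
  ⟨HesseCurve.mk ![1, -1, 0] (fun h => by simpa using congrFun h 0)
    (by simp [hesseForm]; ring)⟩

/-- The first addition formula. -/
def addLaw1 (p q : V3 k) : V3 k :=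
  ![p 0 * p 2 * q 1 ^ 2 - p 1 ^ 2 * q 0 * q 2,
    p 1 * p 2 * q 0 ^ 2 - p 0 ^ 2 * q 1 * q 2,
    p 0 * p 1 * q 2 ^ 2 - p 2 ^ 2 * q 0 * q 1]

/-- The second addition formula. -/
def addLaw2 (p q : V3 k) : V3 k :=
  ![p 0 * p 1 * q 0 ^ 2 - p 2 ^ 2 * q 1 * q 2,
    p 0 * p 2 * q 2 ^ 2 - p 1 ^ 2 * q 0 * q 1,
    p 1 * p 2 * q 1 ^ 2 - p 0 ^ 2 * q 0 * q 2]

theorem hesseForm_addLaw1 {lam : k} {p q : V3 k} (hp : hesseForm lam p = 0)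
    (hq : hesseForm lam q = 0) : hesseForm lam (addLaw1 p q) = 0 := by
  simp only [hesseForm, addLaw1, Matrix.cons_val] at *
  grind

theorem hesseForm_addLaw2 {lam : k} {p q : V3 k} (hp : hesseForm lam p = 0)
    (hq : hesseForm lam q = 0) : hesseForm lam (addLaw2 p q) = 0 := by
  simp only [hesseForm, addLaw2, Matrix.cons_val] at *
  grind

/-- On a smooth curve, at least one of the two addition formulas gives a nonzero vector. -/
theorem addLaw_ne_zero [CharZero k] {lam : k} (hl : lam ^ 3 ≠ 1) {p q : V3 k} (hp0 : p ≠ 0)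
    (hq0 : q ≠ 0) (hp : hesseForm lam p = 0) (hq : hesseForm lam q = 0)
    (h1 : addLaw1 p q = 0) : addLaw2 p q ≠ 0 := by
  intro h2
  have e0 := congrFun h1 0
  have e1 := congrFun h1 1
  have e2 := congrFun h1 2
  have f0 := congrFun h2 0
  have f1 := congrFun h2 1
  have f2 := congrFun h2 2
  simp only [hesseForm, addLaw1, addLaw2, Matrix.cons_val, Pi.zero_apply] at *
  have hp1 : ¬ (p 0 = 0 ∧ p 1 = 0 ∧ p 2 = 0) := fun h => hp0 (by
    ext i; fin_cases i <;> simp [h])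
  have hq1 : ¬ (q 0 = 0 ∧ q 1 = 0 ∧ q 2 = 0) := fun h => hq0 (by
    ext i; fin_cases i <;> simp [h])
  generalize p 0 = a at *
  generalize p 1 = b at *
  generalize p 2 = c at *
  generalize q 0 = x at *
  generalize q 1 = y at *
  generalize q 2 = z at *
  clear h1 h2 hp0 hq0
  by_cases ha : a = 0
  · grind
  by_cases hb : b = 0
  · grind
  by_cases hc : c = 0
  · grind
  have hx : x ≠ 0 := by
    rintro rfl
    simp_all
  have hy : y ≠ 0 := by
    rintro rfl
    simp_all
  have hz : z ≠ 0 := by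
    rintro rfl
    simp_all
  have h3 : a * c * b ^ 2 * x * (y ^ 3 - z ^ 3) = 0 := by grind
  have h4 : b * c * a ^ 2 * z * (x ^ 3 - y ^ 3) = 0 := by grind
  have h5 : y ^ 3 = z ^ 3 := by
    simpa [ha, hb, hc, hx, sub_eq_zero] using h3
  have h6 : x ^ 3 = y ^ 3 := by
    simpa [ha, hb, hc, hz, sub_eq_zero] using h4
  have h7 : 3 * (x ^ 3 - lam * x * y * z) = 0 := by linear_combination hq + 2 * h6 + h5
  have h8 : x ^ 3 = lam * x * y * z := by
    have : (3 : k) ≠ 0 := by norm_num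
    simpa [this, sub_eq_zero] using h7
  apply hl
  have h9 : x ^ 9 * (lam ^ 3 - 1) = 0 := by
    have e : (x ^ 3) ^ 3 = (lam * x * y * z) ^ 3 := by rw [h8]
    have e2 : (lam * x * y * z) ^ 3 = lam ^ 3 * x ^ 3 * y ^ 3 * z ^ 3 := by ring
    rw [e2, ← h5, ← h6] at e
    linear_combination -e
  simpa [hx, sub_eq_zero] using h9

open Classical in
/-- The addition with zero element `(1 : -1 : 0)`: whichever of the two formulas gives a nonzero
vector (where both do, they give the same point; for `λ³ ≠ 1` the last case never occurs). -/
instance (lam : k) : Add (HesseCurve lam) :=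
  ⟨fun p q =>
    if h1 : addLaw1 p.1.rep q.1.rep ≠ 0 then
      HesseCurve.mk (addLaw1 p.1.rep q.1.rep) h1 (hesseForm_addLaw1 p.2 q.2)
    else if h2 : addLaw2 p.1.rep q.1.rep ≠ 0 then
      HesseCurve.mk (addLaw2 p.1.rep q.1.rep) h2 (hesseForm_addLaw2 p.2 q.2)
    else 0⟩

/-- The set `E[n]` of `n`-torsion points, where `n p = p + ⋯ + p`. -/
def torsion (lam : k) (n : ℕ) : Set (HesseCurve lam) := {p | nsmulRec n p = 0}

/-- The translation by `r`. -/
def translation {lam : k} (r : HesseCurve lam) : HesseCurve lam → HesseCurve lam :=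
  fun q => q + r

/-! ### The automorphisms `τ₁, τ₂, τ₃` -/

/-- The bijection of the curve induced by a linear automorphism that preserves its equation. -/
def restrict (lam : k) (g : V3 k ≃ₗ[k] V3 k)
    (h : ∀ v, hesseForm lam (g v) = 0 ↔ hesseForm lam v = 0) :
    Equiv.Perm (HesseCurve lam) :=
  (MulAction.toPerm g : Equiv.Perm (ℙ k (V3 k))).subtypePerm (by
    intro P
    induction P using Projectivization.ind with
    | h v hv =>
      rw [hesseForm_mk, MulAction.toPerm_apply, Projectivization.smul_mk, hesseForm_mk]
      exact h v)

/-- The linear map `(a, b, c) ↦ (b, a, c)`. -/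
def lin1 (k : Type*) [Field k] : V3 k ≃ₗ[k] V3 k where
  toFun v := ![v 1, v 0, v 2]
  invFun v := ![v 1, v 0, v 2]
  map_add' u v := by ext i; fin_cases i <;> simp
  map_smul' c v := by ext i; fin_cases i <;> simp
  left_inv v := by ext i; fin_cases i <;> simp
  right_inv v := by ext i; fin_cases i <;> simp

/-- `τ₁ (a : b : c) = (b : a : c)`. -/
def tau1 (lam : k) : Equiv.Perm (HesseCurve lam) :=
  restrict lam (lin1 k) (fun v => by
    have : hesseForm lam (lin1 k v) = hesseForm lam v := by
      simp [hesseForm, lin1]; ring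
    rw [this])

/-- The linear map `(a, b, c) ↦ (b, a, c ε)`. -/
def lin2 {ε : k} (hε : IsPrimitiveRoot ε 3) : V3 k ≃ₗ[k] V3 k where
  toFun v := ![v 1, v 0, v 2 * ε]
  invFun v := ![v 1, v 0, v 2 * ε⁻¹]
  map_add' u v := by ext i; fin_cases i <;> simp; ring
  map_smul' c v := by ext i; fin_cases i <;> simp; ring
  left_inv v := by
    have := hε.ne_zero (by norm_num)
    ext i; fin_cases i <;> simp [this]
  right_inv v := by
    have := hε.ne_zero (by norm_num)
    ext i; fin_cases i <;> simp [this]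

/-- `τ₂ (a : b : c) = (b : a : c ε)` on the curve with `λ = 0`. -/
def tau2 {lam ε : k} (hlam : lam = 0) (hε : IsPrimitiveRoot ε 3) :
    Equiv.Perm (HesseCurve lam) :=
  restrict lam (lin2 hε) (fun v => by
    have : hesseForm lam (lin2 hε v) = hesseForm lam v := by
      have := hε.pow_eq_one
      simp [hesseForm, lin2, hlam, mul_pow, this]; ring
    rw [this])

/-- The linear map `(a, b, c) ↦ (a ε² + b ε + c, a ε + b ε² + c, a + b + c)`. -/
def lin3 [CharZero k] {ε : k} (hε : IsPrimitiveRoot ε 3) : V3 k ≃ₗ[k] V3 k where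
  toFun v := ![v 0 * ε ^ 2 + v 1 * ε + v 2, v 0 * ε + v 1 * ε ^ 2 + v 2, v 0 + v 1 + v 2]
  invFun v := ![3⁻¹ * (v 0 * ε + v 1 * ε ^ 2 + v 2), 3⁻¹ * (v 0 * ε ^ 2 + v 1 * ε + v 2),
    3⁻¹ * (v 0 + v 1 + v 2)]
  map_add' u v := by ext i; fin_cases i <;> simp <;> ring
  map_smul' c v := by ext i; fin_cases i <;> simp <;> ring
  left_inv v := by
    have h3 : (3 : k) ≠ 0 := by norm_num
    have h : ε ^ 2 + ε + 1 = 0 := by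
      have := hε.geom_sum_eq_zero (by norm_num)
      simp only [Finset.sum_range_succ, Finset.sum_range_zero] at this
      linear_combination this
    ext i; fin_cases i <;> simp <;> field_simp <;> grind
  right_inv v := by
    have h3 : (3 : k) ≠ 0 := by norm_num
    have h : ε ^ 2 + ε + 1 = 0 := by
      have := hε.geom_sum_eq_zero (by norm_num)
      simp only [Finset.sum_range_succ, Finset.sum_range_zero] at this
      linear_combination this
    ext i; fin_cases i <;> simp <;> field_simp <;> grind

/-- `τ₃ (a : b : c) = (a ε² + b ε + c : a ε + b ε² + c : a + b + c)` on the curve with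
`λ = 1 + √3`. -/
def tau3 [CharZero k] {lam s ε : k} (hs : s ^ 2 = 3) (hlam : lam = 1 + s)
    (hε : IsPrimitiveRoot ε 3) : Equiv.Perm (HesseCurve lam) :=
  restrict lam (lin3 hε) (fun v => by
    have h : ε ^ 2 + ε + 1 = 0 := by
      have := hε.geom_sum_eq_zero (by norm_num)
      simp only [Finset.sum_range_succ, Finset.sum_range_zero] at this
      linear_combination this
    have h1 : hesseForm lam (lin3 hε v) = -3 * s * hesseForm lam v := by
      simp [hesseForm, lin3]
      grind
    have h3 : s ≠ 0 := by
      rintro rfl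
      norm_num at hs
    rw [h1]
    simp [h3])

/-- The point `(1 : 1 : λ)` on the curve with `λ = 1 + √3`. -/
def specialPoint {lam s : k} (hs : s ^ 2 = 3) (hlam : lam = 1 + s) : HesseCurve lam :=
  HesseCurve.mk ![1, 1, lam] (fun h => by simpa using congrFun h 0) (by
    simp [hesseForm]
    grind)

/-! ### Subgroups of the group of bijections of the curve -/

/-- The subgroup `T` consists exactly of the translations by the points of `E[n]`. -/
def IsTranslationGroup (lam : k) (n : ℕ) (T : Subgroup (Equiv.Perm (HesseCurve lam))) : Prop :=
  (fun σ : Equiv.Perm (HesseCurve lam) => (σ : HesseCurve lam → HesseCurve lam)) '' T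
    = translation '' torsion lam n

/-- `G` is the internal semidirect product `N ⋊ H`. -/
def IsSemidirect {P : Type*} [Group P] (G N H : Subgroup P) : Prop :=
  G = N ⊔ H ∧ H ≤ Subgroup.normalizer N ∧ N ⊓ H = ⊥

/-- The class of `θ` in `PAut (w)` acts on the curve by the bijection that `θ^*` induces on
`ℙ(V*)` (by the one of `(θ⁻¹)^*`, so that a group homomorphism results). -/
def IsNaturalAction (w : Potential k) (lam : k)
    (Φ : PAut w →* Equiv.Perm (HesseCurve lam)) : Prop :=
  ∀ (θ : Aut w) (q : HesseCurve lam),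
    (Φ (QuotientGroup.mk θ) q).1 = dualCoord (θ.1⁻¹) • q.1

/-- `PAut (w) = G` as groups of automorphisms of the curve: the natural action is defined and
faithful, and its image is `G`. -/
def PAutEq (w : Potential k) (lam : k) (G : Subgroup (Equiv.Perm (HesseCurve lam))) : Prop :=
  ∃ Φ : PAut w →* Equiv.Perm (HesseCurve lam),
    IsNaturalAction w lam Φ ∧ Function.Injective Φ ∧ Φ.range = G

/-- `PAut (w) = N ⋊ H` as groups of automorphisms of the curve. -/
def PAutEqSemidirect (w : Potential k) (lam : k)
    (N H : Subgroup (Equiv.Perm (HesseCurve lam))) : Prop :=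
  ∃ G : Subgroup (Equiv.Perm (HesseCurve lam)), IsSemidirect G N H ∧ PAutEq w lam G

end Sklyanin

end

open Sklyanin

noncomputable section

namespace Sklyanin

variable {k : Type*} [Field k]

/-! ### Trilinear forms and the Hesse pencil -/

/-! Evaluating a potential at triples of functionals turns it into the trilinear form `form a b c`
on `V*`. Thus `θ` lies in `Aut (potential a b c)` exactly when `g = dualCoord θ` multiplies this
form by some `μ ≠ 0` (`mem_Aut_potential_iff`).

Write S for the sum of the cubes of the coordinates, T for their product, and F = S - 3λT.
Contracting the form with `u` gives a 3×3 matrix whose determinant is -abc·F(u), because (a : b : c)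
lies on the curve. Hence `g` multiplies F by μ³/det(g)² and acts on the curve. On the diagonal the
form is the cubic C = 3(a+b)T + cS, which `g` multiplies by μ. Since p is not a flex, C and F are
different members of the Hesse pencil.

If `g` multiplies F and C by the same scalar, it multiplies S and T by this scalar. Preserving T up
to a scalar makes `g` monomial, and S then leaves, up to scalars, only the Heisenberg group and its
coset of the transposition (`monomial_classification`). For a ≠ b the alternating part of the form
is a multiple of the determinant, so μ = det g; the two scalars agree, and the sign of the
determinant excludes the transposition (`Scales.isHeis`).

For a = b, that is p ∈ E[2], the transposition does preserve the form. If F and C are scaled by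
different numbers, comparison with the Hessian of F shows that C is proportional to this Hessian
(`Scales.isHeisSwap_or`). This forces λ⁶ - 20λ³ - 8 = 0, hence j = 12³, and for λ = 1 + √3 it forces
p = (1 : 1 : λ). There the Fourier matrix `lin3`, with square 3·`lin1`, is an additional symmetry,
and the only one up to those already found (`Scales.isHeisSwap_or_lin3`).

On the curve, the Heisenberg group induces exactly the translations by E[3] (`mem_torsion_three`,
`add_flex`). The action is faithful modulo scalars because the curve meets each of two coordinate
lines in three distinct points (`Induces.scalar`). -/

/-- The trilinear form on `V*` given by the Sklyanin potential. -/
def form (a b c : k) (u v t : V3 k) : k :=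
  a * (u 0 * v 1 * t 2 + u 1 * v 2 * t 0 + u 2 * v 0 * t 1)
    + b * (u 0 * v 2 * t 1 + u 1 * v 0 * t 2 + u 2 * v 1 * t 0)
    + c * (u 0 * v 0 * t 0 + u 1 * v 1 * t 1 + u 2 * v 2 * t 2)

/-- `g` multiplies the trilinear form of the potential by `μ`. -/
def Scales (a b c : k) (g : V3 k ≃ₗ[k] V3 k) (μ : k) : Prop :=
  ∀ u v t, form a b c (g u) (g v) (g t) = μ * form a b c u v t

/-- The sum of the cubes of the coordinates. -/
def cubeSum (v : V3 k) : k := v 0 ^ 3 + v 1 ^ 3 + v 2 ^ 3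

/-- The product of the coordinates. -/
def coordProd (v : V3 k) : k := v 0 * v 1 * v 2

theorem form_self (a b c : k) (v : V3 k) :
    form a b c v v v = 3 * (a + b) * coordProd v + c * cubeSum v := by
  simp only [form, coordProd, cubeSum]; ring

theorem hesseForm_eq (lam : k) (v : V3 k) :
    hesseForm lam v = cubeSum v - 3 * lam * coordProd v := by
  simp only [hesseForm, coordProd, cubeSum]; ring

/-- The determinant of a linear automorphism in the standard basis. -/
def gdet (g : V3 k ≃ₗ[k] V3 k) : k := (LinearMap.toMatrix' (g : V3 k →ₗ[k] V3 k)).det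

theorem gdet_eq (g : V3 k ≃ₗ[k] V3 k) : gdet g =
    (Matrix.of fun i j => g (Pi.single j 1) i : Matrix (Fin 3) (Fin 3) k).det := by
  rw [gdet]
  congr 1

theorem gdet_ne_zero (g : V3 k ≃ₗ[k] V3 k) : gdet g ≠ 0 := by
  have := LinearEquiv.isUnit_det' g
  rw [← LinearMap.det_toMatrix'] at this
  exact this.ne_zero

/-- The Gram matrix of the potential contracted with `u` in the first slot. -/
def contraction (a b c : k) (u : V3 k) : Matrix (Fin 3) (Fin 3) k :=
  Matrix.of fun i j => form a b c u (Pi.single i 1) (Pi.single j 1)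

/-- For (a : b : c) on the curve with parameter λ, the right-hand side is -abc times the Hesse form
of `u`: the curve is recovered from the potential as a determinantal locus. With a = b = -λ/2 and c
= 1 the determinant is, up to a constant, the Hessian of the Hesse form. -/
theorem det_contraction (a b c : k) (u : V3 k) : (contraction a b c u).det =
    (a ^ 3 + b ^ 3 + c ^ 3) * coordProd u - a * b * c * cubeSum u := by
  simp [contraction, Matrix.det_fin_three, form, coordProd, cubeSum]
  ring

theorem Scales.det_contraction {a b c μ : k} {g : V3 k ≃ₗ[k] V3 k} (h : Scales a b c g μ)
    (u : V3 k) :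
    gdet g ^ 2 * (contraction a b c (g u)).det = μ ^ 3 * (contraction a b c u).det := by
  -- Gᵀ M(gu) G = μ M(u), where M is the Gram matrix and G the matrix of `g`.
  have key : (LinearMap.toMatrix' (g : V3 k →ₗ[k] V3 k)).transpose * contraction a b c (g u)
      * LinearMap.toMatrix' (g : V3 k →ₗ[k] V3 k) = μ • contraction a b c u := by
    ext i j
    simp only [Matrix.smul_apply, contraction, Matrix.of_apply, smul_eq_mul]
    rw [← h]
    simp [Matrix.mul_apply, Fin.sum_univ_three, LinearMap.toMatrix'_apply, form]
    ring
  have := congrArg Matrix.det key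
  rw [Matrix.det_mul, Matrix.det_mul, Matrix.det_transpose, Matrix.det_smul] at this
  simp only [Fintype.card_fin] at this
  rw [← this, gdet]
  ring

/-- Antisymmetrizing the form in its first two slots gives (a - b) times the determinant of (u, v,
t), which `g` multiplies by det g. -/
theorem Scales.eq_gdet {a b c μ : k} {g : V3 k ≃ₗ[k] V3 k} (h : Scales a b c g μ)
    (hab : a ≠ b) : μ = gdet g := by
  have h1 := h (Pi.single 0 1) (Pi.single 1 1) (Pi.single 2 1)
  have h2 := h (Pi.single 1 1) (Pi.single 0 1) (Pi.single 2 1)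
  have h3 : (a - b) * μ = (a - b) * gdet g := by
    rw [gdet_eq, Matrix.det_fin_three]
    simp [form] at h1 h2
    simp only [Matrix.of_apply]
    linear_combination h2 - h1
  exact mul_left_cancel₀ (sub_ne_zero.2 hab) h3

theorem Scales.cubic {a b c μ : k} {g : V3 k ≃ₗ[k] V3 k} (h : Scales a b c g μ) (v : V3 k) :
    3 * (a + b) * coordProd (g v) + c * cubeSum (g v)
      = μ * (3 * (a + b) * coordProd v + c * cubeSum v) := by
  rw [← form_self, h, form_self]

/-- Polarization of an identity between cubic forms. -/
theorem form_polarization [CharZero k] {a c a' c' : k} {g : V3 k ≃ₗ[k] V3 k}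
    (h : ∀ v, form a a c (g v) (g v) (g v) = form a' a' c' v v v) (u v t : V3 k) :
    form a a c (g u) (g v) (g t) = form a' a' c' u v t := by
  have pol : ∀ (a c : k) (u v t : V3 k), 6 * form a a c u v t =
      form a a c (u + v + t) (u + v + t) (u + v + t)
      - form a a c (u + v) (u + v) (u + v) - form a a c (u + t) (u + t) (u + t)
      - form a a c (v + t) (v + t) (v + t) + form a a c u u u + form a a c v v v
      + form a a c t t t := by
    intro a c u v t
    simp only [form, Pi.add_apply]
    ring
  have h6 : (6 : k) ≠ 0 := by norm_num
  apply mul_left_cancel₀ h6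
  rw [pol, pol]
  simp only [← map_add, h]

/-! ### Monomial matrices -/

/-- The element `v ↦ (ω^i v_{i+j})_i` of the Heisenberg group. -/
def heis {ω : k} (hω : ω ^ 3 = 1) (j : Fin 3) : V3 k ≃ₗ[k] V3 k where
  toFun v i := ω ^ (i : ℕ) * v (i + j)
  invFun v i := ω ^ (2 * ((i - j : Fin 3) : ℕ)) * v (i - j)
  map_add' u v := by ext i; simp [mul_add]
  map_smul' c v := by ext i; simp; ring
  left_inv v := by
    ext i
    simp only [sub_add_cancel, ← mul_assoc, ← pow_add]
    rw [show ∀ n : ℕ, 2 * n + n = 3 * n by intro n; ring, pow_mul, hω, one_pow, one_mul]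
  right_inv v := by
    ext i
    simp only [add_sub_cancel_right, ← mul_assoc, ← pow_add]
    rw [show ∀ n : ℕ, n + 2 * n = 3 * n by intro n; ring, pow_mul, hω, one_pow, one_mul]

theorem heis_apply {ω : k} (hω : ω ^ 3 = 1) (j : Fin 3) (v : V3 k) (i : Fin 3) :
    heis hω j v i = ω ^ (i : ℕ) * v (i + j) := rfl

theorem form_heis (a b c : k) {ω : k} (hω : ω ^ 3 = 1) (j : Fin 3) (u v t : V3 k) :
    form a b c (heis hω j u) (heis hω j v) (heis hω j t) = form a b c u v t := by
  fin_cases j <;> simp [form, heis_apply] <;> grind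

theorem form_lin1 (a c : k) (u v t : V3 k) :
    form a a c (lin1 k u) (lin1 k v) (lin1 k t) = form a a c u v t := by
  simp [form, lin1]; ring

/-- A product of three linear forms in two variables vanishes only if one factor does. The values at
(1, 0), (0, 1), (1, 1), (1, -1) suffice to isolate the four coefficients. -/
theorem pairing_eq_zero_of_prod_eq_zero [CharZero k] {p q : Fin 3 → k}
    (h : ∀ y z : k, (p 0 * y + q 0 * z) * (p 1 * y + q 1 * z) * (p 2 * y + q 2 * z) = 0) :
    ∃ i, p i = 0 ∧ q i = 0 := by
  have h1 := h 1 0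
  have h2 := h 0 1
  have h3 := h 1 1
  have h4 := h 1 (-1)
  simp only [mul_one, mul_zero, add_zero, zero_add, mul_neg] at h1 h2 h3 h4
  have e1 : p 0 * p 1 * q 2 + p 0 * q 1 * p 2 + q 0 * p 1 * p 2 = 0 := by
    have : (2 : k) ≠ 0 := by norm_num
    apply mul_left_cancel₀ this
    linear_combination h3 - h4 - 2 * h2
  have e2 : p 0 * q 1 * q 2 + q 0 * q 1 * p 2 + q 0 * p 1 * q 2 = 0 := by
    have : (2 : k) ≠ 0 := by norm_num
    apply mul_left_cancel₀ this
    linear_combination h3 + h4 - 2 * h1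
  by_contra! hne
  have n0 := hne 0
  have n1 := hne 1
  have n2 := hne 2
  clear h h3 h4 hne
  generalize p 0 = p0, p 1 = p1, p 2 = p2, q 0 = q0, q 1 = q1, q 2 = q2 at *
  by_cases a0 : p0 = 0 <;> by_cases a1 : p1 = 0 <;> by_cases a2 : p2 = 0 <;> simp_all

/-- If the product of the coordinates of `g v` is a multiple of the product of the coordinates
of `v`, then `g` is monomial. -/
theorem exists_coord_of_coordProd [CharZero k] {g : V3 k ≃ₗ[k] V3 k} {μ : k}
    (h : ∀ v, coordProd (g v) = μ * coordProd v) (j : Fin 3) :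
    ∃ i d, ∀ v, g v i = d * v j := by
  have hg : ∀ v i, g v i = g (Pi.single 0 1) i * v 0 + g (Pi.single 1 1) i * v 1
      + g (Pi.single 2 1) i * v 2 := by
    intro v i
    have hv : v = v 0 • Pi.single 0 1 + v 1 • Pi.single 1 1 + v 2 • Pi.single 2 1 := by
      ext i; fin_cases i <;> simp
    conv_lhs => rw [hv]
    simp
    ring
  -- On the line v_j = 0 the product of the coordinates of `g v` vanishes, so one of these
  -- coordinates vanishes on that whole line.
  have key : ∀ y z : k, coordProd (g (y • Pi.single (j + 1) 1 + z • Pi.single (j + 2) 1)) = 0 := by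
    intro y z
    rw [h]
    fin_cases j <;> simp [coordProd]
  obtain ⟨i, h1, h2⟩ := pairing_eq_zero_of_prod_eq_zero
    (p := g (Pi.single (j + 1) 1)) (q := g (Pi.single (j + 2) 1)) (by
      intro y z
      rw [← key y z]
      simp [coordProd]
      ring)
  refine ⟨i, g (Pi.single j 1) i, fun v => ?_⟩
  rw [hg]
  clear hg key h
  fin_cases j <;> simp at h1 h2 <;> simp [h1, h2]

theorem perm_fin_three : ∀ ρ : Fin 3 → Fin 3, Function.Injective ρ →
    (∃ j, ∀ i, ρ i = i + j) ∨ (∃ j, ∀ i, ρ i = Equiv.swap 0 1 (i + j)) := by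
  decide

theorem lin1_apply (v : V3 k) (i : Fin 3) : lin1 k v i = v (Equiv.swap 0 1 i) := by
  fin_cases i <;> simp [lin1, Equiv.swap_apply_of_ne_of_ne]

/-- A linear automorphism that multiplies `x³ + y³ + z³` and `xyz` by the same scalar belongs, up
to a scalar, to the Heisenberg group or to its coset of the transposition. -/
theorem monomial_classification [CharZero k] {g : V3 k ≃ₗ[k] V3 k} {μ : k} (hμ : μ ≠ 0)
    (hT : ∀ v, coordProd (g v) = μ * coordProd v) (hS : ∀ v, cubeSum (g v) = μ * cubeSum v) :
    ∃ (ω : k) (hω : ω ^ 3 = 1) (j : Fin 3) (κ : k), κ ≠ 0 ∧ κ ^ 3 = μ ∧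
      ((∀ v, g v = κ • heis hω j v) ∨ (∀ v, g v = κ • heis hω j (lin1 k v))) := by
  choose π d hd using exists_coord_of_coordProd hT
  have hd0 : ∀ j, d j ≠ 0 := by
    intro j hj
    have := hd j (g.symm (Pi.single (π j) 1))
    simp [hj] at this
  have hπ : Function.Injective π := by
    intro i j hij
    by_contra hne
    have h1 := hd i (Pi.single i 1)
    have h2 := hd j (Pi.single i 1)
    rw [← hij, h1, Pi.single_eq_same, Pi.single_eq_of_ne (Ne.symm hne)] at h2
    simp [hd0] at h2
  obtain ⟨ρ, hρ⟩ := Finite.surjective_of_injective hπ |>.hasRightInverse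
  have hg : ∀ v i, g v i = d (ρ i) * v (ρ i) := fun v i => by rw [← hd, hρ]
  have hρi : Function.Injective ρ := hρ.injective
  set e : Fin 3 → k := fun i => d (ρ i) with he
  have he0 : ∀ i, e i ≠ 0 := fun i => hd0 _
  have hg : ∀ v i, g v i = e i * v (ρ i) := hg
  have hcube : ∀ i, e i ^ 3 = μ := by
    intro i
    have := hS (Pi.single (ρ i) 1)
    simp only [cubeSum, hg, Pi.single_apply, hρi.eq_iff] at this
    revert this
    generalize ρ i = r
    fin_cases i <;> fin_cases r <;> simp
  have hprod : e 0 * e 1 * e 2 = μ := by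
    have := hT (fun _ => 1)
    simpa [coordProd, hg] using this
  have h1 := hcube 1
  have h0 := hcube 0
  have n0 := he0 0
  have n1 := he0 1
  have hω : (e 1 / e 0) ^ 3 = 1 := by rw [div_pow, h0, h1, div_self hμ]
  -- The entries have the same cube μ, and their product is also μ; so e₂ = e₁³/(e₀e₁) = e₁²/e₀.
  have hei : ∀ i : Fin 3, e i = e 0 * (e 1 / e 0) ^ (i : ℕ) := by
    intro i
    fin_cases i
    · simp
    · simp; field_simp
    · simp
      field_simp
      apply mul_left_cancel₀ n1
      linear_combination hprod - h1
  refine ⟨e 1 / e 0, hω, ?_⟩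
  obtain ⟨j, hj⟩ | ⟨j, hj⟩ := perm_fin_three ρ hρi
  · refine ⟨j, e 0, n0, h0, Or.inl fun v => ?_⟩
    ext i
    rw [hg, hj, hei, Pi.smul_apply, heis_apply, smul_eq_mul, mul_assoc]
  · refine ⟨j, e 0, n0, h0, Or.inr fun v => ?_⟩
    ext i
    rw [hg, hj, hei, Pi.smul_apply, heis_apply, lin1_apply, smul_eq_mul, mul_assoc]

/-- `g` belongs, up to a scalar, to the Heisenberg group. -/
def IsHeis (g : V3 k ≃ₗ[k] V3 k) : Prop :=
  ∃ (ω : k) (hω : ω ^ 3 = 1) (j : Fin 3) (κ : k), κ ≠ 0 ∧ ∀ v, g v = κ • heis hω j v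

/-! ### Scalars on the Hesse pencil and non-symmetric potentials -/

theorem cubeSum_eq_add {lam : k} (v : V3 k) :
    cubeSum v = hesseForm lam v + 3 * lam * coordProd v := by
  rw [hesseForm_eq]; ring

/-- If `g` multiplies two different members of the Hesse pencil by the same scalar, it multiplies
all of them by this scalar. -/
theorem pencil_scaled [CharZero k] {lam d c α : k} {g : V3 k ≃ₗ[k] V3 k}
    (hd : d + lam * c ≠ 0)
    (hF : ∀ v, hesseForm lam (g v) = α * hesseForm lam v)
    (hC : ∀ v, 3 * d * coordProd (g v) + c * cubeSum (g v)
      = α * (3 * d * coordProd v + c * cubeSum v)) :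
    (∀ v, coordProd (g v) = α * coordProd v) ∧ (∀ v, cubeSum (g v) = α * cubeSum v) := by
  have h3 : (3 : k) ≠ 0 := by norm_num
  have hT : ∀ v, coordProd (g v) = α * coordProd v := by
    intro v
    apply mul_left_cancel₀ (mul_ne_zero h3 hd)
    have h1 := hF v
    have h2 := hC v
    rw [hesseForm_eq, hesseForm_eq] at h1
    linear_combination h2 - c * h1
  refine ⟨hT, fun v => ?_⟩
  rw [cubeSum_eq_add (lam := lam), hF, hT, cubeSum_eq_add (lam := lam) v]
  ring

/-- The line x + y + λz = 0 is the tangent at the flex (1 : -1 : 0), so it meets the curve nowhere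
else. Nonvanishing at (a, b, c) says that the cubic of the potential is not proportional to the
Hesse form. -/
theorem pencil_nondegenerate {lam a b c : k} (hl : lam ^ 3 ≠ 1) (hc : c ≠ 0)
    (h : a ^ 3 + b ^ 3 + c ^ 3 = 3 * lam * a * b * c) : a + b + lam * c ≠ 0 := by
  intro h0
  apply hl
  apply mul_left_cancel₀ (pow_ne_zero 3 hc)
  linear_combination ((a + b) ^ 2 - (a + b) * lam * c + lam ^ 2 * c ^ 2 - 3 * a * b) * h0 - h

theorem Scales.hesseForm [CharZero k] {lam a b c μ : k} {g : V3 k ≃ₗ[k] V3 k}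
    (h : Scales a b c g μ) (ha : a ≠ 0) (hb : b ≠ 0) (hc : c ≠ 0)
    (he : a ^ 3 + b ^ 3 + c ^ 3 = 3 * lam * a * b * c) (v : V3 k) :
    hesseForm lam (g v) = μ ^ 3 / gdet g ^ 2 * hesseForm lam v := by
  have h1 := h.det_contraction v
  rw [Sklyanin.det_contraction, Sklyanin.det_contraction, he] at h1
  have hg := gdet_ne_zero g
  field_simp
  apply mul_left_cancel₀ (mul_ne_zero (mul_ne_zero ha hb) hc)
  rw [hesseForm_eq, hesseForm_eq]
  linear_combination -h1

/-- The sign is that of the transposition: the cyclic shifts are even and 1·ω·ω² = 1. -/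
theorem gdet_lin1_comp {g : V3 k ≃ₗ[k] V3 k} {ω κ : k} {hω : ω ^ 3 = 1} {j : Fin 3}
    (h : ∀ v, g v = κ • heis hω j (lin1 k v)) : gdet g = -κ ^ 3 := by
  rw [gdet_eq, Matrix.det_fin_three]
  simp only [Matrix.of_apply, h, Pi.smul_apply, heis_apply, lin1_apply, Pi.single_apply]
  fin_cases j <;> simp [Equiv.swap_apply_def] <;> linear_combination κ ^ 3 * hω

/-- Automorphisms of a Sklyanin potential that is not symmetric. -/
theorem Scales.isHeis [CharZero k] {lam a b c μ : k} {g : V3 k ≃ₗ[k] V3 k}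
    (h : Scales a b c g μ) (hl : lam ^ 3 ≠ 1) (ha : a ≠ 0) (hb : b ≠ 0) (hc : c ≠ 0)
    (he : a ^ 3 + b ^ 3 + c ^ 3 = 3 * lam * a * b * c) (hab : a ≠ b) : IsHeis g := by
  have hμ := h.eq_gdet hab
  have hμ0 : μ ≠ 0 := hμ ▸ gdet_ne_zero g
  have hF := h.hesseForm ha hb hc he
  have e : μ ^ 3 / gdet g ^ 2 = μ := by rw [← hμ]; field_simp
  rw [e] at hF
  obtain ⟨hT, hS⟩ := pencil_scaled (pencil_nondegenerate hl hc he) hF h.cubic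
  obtain ⟨ω, hω, j, κ, hκ, hκμ, h1 | h1⟩ := monomial_classification hμ0 hT hS
  · exact ⟨ω, hω, j, κ, hκ, h1⟩
  · exfalso
    have := gdet_lin1_comp h1
    rw [hκμ, ← hμ, eq_neg_iff_add_eq_zero, ← two_mul] at this
    simp [hμ0] at this

/-! ### Symmetric potentials and the Hessian -/

/-- `g` belongs, up to a scalar, to the Heisenberg group or to its coset of the transposition. -/
def IsHeisSwap (g : V3 k ≃ₗ[k] V3 k) : Prop :=
  IsHeis g ∨ IsHeis (g * lin1 k)

theorem lin1_lin1 (v : V3 k) : lin1 k (lin1 k v) = v := by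
  ext i; fin_cases i <;> simp [lin1]

theorem isHeisSwap_of_scaled [CharZero k] {g : V3 k ≃ₗ[k] V3 k} {μ : k} (hμ : μ ≠ 0)
    (hT : ∀ v, coordProd (g v) = μ * coordProd v) (hS : ∀ v, cubeSum (g v) = μ * cubeSum v) :
    IsHeisSwap g := by
  obtain ⟨ω, hω, j, κ, hκ, -, h1 | h1⟩ := monomial_classification hμ hT hS
  · exact Or.inl ⟨ω, hω, j, κ, hκ, h1⟩
  · refine Or.inr ⟨ω, hω, j, κ, hκ, fun v => ?_⟩
    rw [LinearEquiv.mul_apply, h1, lin1_lin1]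

/-- The coefficients are those of the symmetric trilinear form whose diagonal is the Hesse form.
`Scales.det_contraction` then controls the Hessian. -/
theorem hesseForm_scales [CharZero k] {lam α : k} {g : V3 k ≃ₗ[k] V3 k}
    (h : ∀ v, Sklyanin.hesseForm lam (g v) = α * Sklyanin.hesseForm lam v) :
    Scales (-lam / 2) (-lam / 2) 1 g α := by
  intro u v t
  have : α * form (-lam / 2) (-lam / 2) 1 u v t
      = form (α * (-lam / 2)) (α * (-lam / 2)) (α * 1) u v t := by
    simp only [form]; ring
  rw [this]
  refine form_polarization (fun v => ?_) u v t
  have := h v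
  rw [hesseForm_eq, hesseForm_eq] at this
  rw [form_self, form_self]
  linear_combination this

/-- Automorphisms of a symmetric Sklyanin potential: if the cubic form of the potential and the
Hesse cubic are scaled differently, the Hessian of the latter is proportional to the former. -/
theorem Scales.isHeisSwap_or [CharZero k] {lam a c μ : k} {g : V3 k ≃ₗ[k] V3 k}
    (h : Scales a a c g μ) (hμ : μ ≠ 0) (hl : lam ^ 3 ≠ 1) (ha : a ≠ 0) (hc : c ≠ 0)
    (he : a ^ 3 + a ^ 3 + c ^ 3 = 3 * lam * a * a * c) :
    IsHeisSwap g ∨ (c * (4 - lam ^ 3) = -6 * lam ^ 2 * a ∧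
      ∃ α, α ≠ μ ∧ α ^ 4 = μ ^ 4 ∧ ∀ v, Sklyanin.hesseForm lam (g v) = α * Sklyanin.hesseForm lam v) := by
  have hF := h.hesseForm ha ha hc he
  have hg := gdet_ne_zero g
  have hα : gdet g ^ 2 * (μ ^ 3 / gdet g ^ 2) = μ ^ 3 := by field_simp
  have hα0 : μ ^ 3 / gdet g ^ 2 ≠ 0 := by positivity
  generalize μ ^ 3 / gdet g ^ 2 = α at hF hα hα0
  have hΔ := pencil_nondegenerate hl hc he
  by_cases hαμ : α = μ
  · subst hαμ
    obtain ⟨hT, hS⟩ := pencil_scaled hΔ hF h.cubic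
    exact Or.inl (isHeisSwap_of_scaled hμ hT hS)
  right
  have hH := (hesseForm_scales hF).det_contraction
  have hC := h.cubic
  set E := 6 * a * lam ^ 2 + 4 * c - c * lam ^ 3 with hE
  -- With H the contraction determinant of the Hesse form F and C the cubic of the potential, 12(2a
  -- + λc)H = -E·F + 4(1 - λ³)C. Here F, C and det(g)²H are multiplied by α, μ and α³ respectively;
  -- F and C are independent, so both coefficients in `key` vanish.
  have key : ∀ v, (gdet g ^ 2 * α - α ^ 3) * -E * Sklyanin.hesseForm lam v
      + 4 * (1 - lam ^ 3) * (gdet g ^ 2 * μ - α ^ 3)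
        * (3 * (a + a) * coordProd v + c * cubeSum v) = 0 := by
    intro v
    have h1 := hF v
    have h2 := hC v
    have h3 := hH v
    rw [Sklyanin.det_contraction, Sklyanin.det_contraction] at h3
    rw [hesseForm_eq, hesseForm_eq] at h1
    rw [hesseForm_eq]
    linear_combination 12 * (a + a + lam * c) * h3 + gdet g ^ 2 * E * h1
      - 4 * gdet g ^ 2 * (1 - lam ^ 3) * h2
  have k1 := key ![1, 0, 0]
  have k2 := key ![1, 1, 1]
  simp [hesseForm_eq, cubeSum, coordProd] at k1 k2
  have l1 : 1 - lam ^ 3 ≠ 0 := sub_ne_zero.2 (Ne.symm hl)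
  have h12 : (12 : k) ≠ 0 := by norm_num
  have hy : gdet g ^ 2 * μ - α ^ 3 = 0 := by
    apply mul_left_cancel₀ (mul_ne_zero (mul_ne_zero h12 l1) hΔ)
    linear_combination k2 - (3 - 3 * lam) * k1
  rw [hy] at k1
  refine ⟨?_, α, hαμ, ?_, hF⟩
  · have : E = 0 := by
      by_contra hE0
      simp [hE0] at k1
      apply hαμ
      have : α ^ 2 = gdet g ^ 2 := by
        apply mul_left_cancel₀ hα0
        linear_combination -k1
      apply mul_left_cancel₀ (pow_ne_zero 2 hα0)
      linear_combination -hy - μ * this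
    linear_combination this
  · linear_combination (-α) * hy + μ * hα

/-- Eliminates c/a between the curve equation and the proportionality to the Hessian. -/
theorem lam_of_hessian [CharZero k] {lam a c : k} (hl : lam ^ 3 ≠ 1) (ha : a ≠ 0) (hc : c ≠ 0)
    (he : a ^ 3 + a ^ 3 + c ^ 3 = 3 * lam * a * a * c)
    (h : c * (4 - lam ^ 3) = -6 * lam ^ 2 * a) :
    lam ≠ 0 ∧ lam ^ 6 - 20 * lam ^ 3 - 8 = 0 := by
  have l1 : lam ^ 3 - 1 ≠ 0 := sub_ne_zero.2 hl
  constructor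
  · rintro rfl
    simp [hc] at h
  · have h16 : (16 : k) ≠ 0 := by norm_num
    apply mul_left_cancel₀ (mul_ne_zero (mul_ne_zero h16 (pow_ne_zero 3 ha)) l1)
    have hcube : (c * (4 - lam ^ 3)) ^ 3 = (-6 * lam ^ 2 * a) ^ 3 := by rw [h]
    linear_combination (4 - lam ^ 3) ^ 3 * he - hcube + 3 * lam * a ^ 2 * (4 - lam ^ 3) ^ 2 * h

theorem jInv_of_hessian [CharZero k] {lam : k} (hl : lam ^ 3 ≠ 1)
    (h : lam ^ 6 - 20 * lam ^ 3 - 8 = 0) : jInv lam = 12 ^ 3 := by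
  have l1 : lam ^ 3 - 1 ≠ 0 := sub_ne_zero.2 hl
  rw [jInv, div_eq_iff (pow_ne_zero 3 l1)]
  -- Up to the denominator, j - 12³ is 27(λ⁶ - 20λ³ - 8)².
  linear_combination 27 * (lam ^ 6 - 20 * lam ^ 3 - 8) * h

/-- A member of the Hesse pencil that is a product of three linear forms is singular. -/
theorem triangle [CharZero k] {σ τ : k} {g : V3 k ≃ₗ[k] V3 k} (hσ : σ ≠ 0)
    (h : ∀ v, coordProd (g v) = σ * cubeSum v + τ * coordProd v) : τ ^ 3 = (-3 * σ) ^ 3 := by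
  have key := form_polarization (g := g) (a := 1) (c := 0) (a' := τ) (c' := 6 * σ) (by
    intro v
    rw [form_self, form_self, h]
    ring)
  -- `v` is a vertex of the triangle, where two of the three lines meet; all partial derivatives of
  -- the cubic vanish there. Multiplying the three equations gives the claim.
  obtain ⟨v, hv⟩ := g.surjective (Pi.single 2 1)
  have hz : ∀ t, form τ τ (6 * σ) v v t = 0 := by
    intro t
    rw [← key, hv]
    simp [form]
  have hv0 : v ≠ 0 := by
    rintro rfl
    have := congrFun hv 2
    simp at this
  have e0 := hz (Pi.single 0 1)
  have e1 := hz (Pi.single 1 1)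
  have e2 := hz (Pi.single 2 1)
  simp [form] at e0 e1 e2
  have h2 : (2 : k) ≠ 0 := by norm_num
  have f0 : 3 * σ * v 0 ^ 2 = -τ * (v 1 * v 2) := by
    apply mul_left_cancel₀ h2; linear_combination e0
  have f1 : 3 * σ * v 1 ^ 2 = -τ * (v 2 * v 0) := by
    apply mul_left_cancel₀ h2; linear_combination e1
  have f2 : 3 * σ * v 2 ^ 2 = -τ * (v 0 * v 1) := by
    apply mul_left_cancel₀ h2; linear_combination e2
  by_cases hv012 : v 0 * v 1 * v 2 = 0
  · exfalso
    apply hv0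
    rcases mul_eq_zero.1 hv012 with h' | h'
    · rcases mul_eq_zero.1 h' with h' | h'
      · simp [h', hσ] at f1 f2
        ext i; fin_cases i <;> simp [*]
      · simp [h', hσ] at f0 f2
        ext i; fin_cases i <;> simp [*]
    · simp [h', hσ] at f0 f1
      ext i; fin_cases i <;> simp [*]
  · apply mul_left_cancel₀ (pow_ne_zero 2 hv012)
    have : (3 * σ * v 0 ^ 2) * (3 * σ * v 1 ^ 2) * (3 * σ * v 2 ^ 2)
      = (-τ * (v 1 * v 2)) * (-τ * (v 2 * v 0)) * (-τ * (v 0 * v 1)) := by rw [f0, f1, f2]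
    linear_combination this

/-! ### The Fourier matrix and the curve with λ = 1 + √3 -/

theorem coordProd_lin3 [CharZero k] {ε : k} (hε : IsPrimitiveRoot ε 3) (v : V3 k) :
    coordProd (lin3 hε v) = cubeSum v - 3 * coordProd v := by
  have h : ε ^ 2 + ε + 1 = 0 := by
    have := hε.geom_sum_eq_zero (by norm_num)
    simp only [Finset.sum_range_succ, Finset.sum_range_zero] at this
    linear_combination this
  simp [coordProd, cubeSum, lin3]
  grind

theorem cubeSum_lin3 [CharZero k] {ε : k} (hε : IsPrimitiveRoot ε 3) (v : V3 k) :
    cubeSum (lin3 hε v) = 3 * cubeSum v + 18 * coordProd v := by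
  have h : ε ^ 2 + ε + 1 = 0 := by
    have := hε.geom_sum_eq_zero (by norm_num)
    simp only [Finset.sum_range_succ, Finset.sum_range_zero] at this
    linear_combination this
  simp [coordProd, cubeSum, lin3]
  grind

theorem eq_of_hessian [CharZero k] {lam s a c : k} (hs : s ^ 2 = 3) (h1 : lam = 1 + s)
    (h : c * (4 - lam ^ 3) = -6 * lam ^ 2 * a) : c = lam * a := by
  have h2 : lam ^ 2 = 2 * lam + 2 := by subst h1; linear_combination hs
  have hl : lam ≠ 0 := by
    rintro rfl
    norm_num at h2
  have h6 : (6 : k) ≠ 0 := by norm_num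
  apply mul_left_cancel₀ (mul_ne_zero h6 hl)
  linear_combination -h - c * (lam + 2) * h2

/-- Automorphisms of the symmetric potential at the point `(1 : 1 : 1 + √3)`. -/
theorem Scales.isHeisSwap_or_lin3 [CharZero k] {lam s a c μ ε : k} {g : V3 k ≃ₗ[k] V3 k}
    (h : Scales a a c g μ) (hμ : μ ≠ 0) (hl : lam ^ 3 ≠ 1) (ha : a ≠ 0) (hc : c ≠ 0)
    (he : a ^ 3 + a ^ 3 + c ^ 3 = 3 * lam * a * a * c)
    (hs : s ^ 2 = 3) (h1 : lam = 1 + s) (hε : IsPrimitiveRoot ε 3) :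
    IsHeisSwap g ∨ IsHeisSwap (g * lin3 hε) := by
  obtain h' | ⟨hE, α, hαμ, hα4, hF⟩ := h.isHeisSwap_or hμ hl ha hc he
  · exact Or.inl h'
  right
  have hca := eq_of_hessian hs h1 hE
  have s0 : s ≠ 0 := by rintro rfl; norm_num at hs
  have h6 : (6 : k) ≠ 0 := by norm_num
  -- Since (1 + s)(1 - s) = -2, the cubic of the potential is c times the Hesse form with the
  -- conjugate parameter 1 - s.
  have hC : ∀ v, cubeSum (g v) - 3 * (1 - s) * coordProd (g v)
      = μ * (cubeSum v - 3 * (1 - s) * coordProd v) := by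
    intro v
    apply mul_left_cancel₀ hc
    have := h.cubic v
    have e : 2 * a = -c * (1 - s) := by rw [hca, h1]; linear_combination -a * hs
    linear_combination this - 3 * (coordProd (g v) - μ * coordProd v) * e
  have hT : ∀ v, coordProd (g v) = (μ - α) / (6 * s) * cubeSum v
      + (-3 * ((1 - s) * μ - (1 + s) * α)) / (6 * s) * coordProd v := by
    intro v
    have e1 := hF v
    have e2 := hC v
    rw [hesseForm_eq, hesseForm_eq, h1] at e1
    field_simp
    linear_combination e2 - e1
  have hσ : μ - α ≠ 0 := sub_ne_zero.2 (Ne.symm hαμ)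
  have tri := triangle (div_ne_zero hσ (mul_ne_zero h6 s0)) hT
  -- With d = μ - α and e = μ + α, `tri` reads (d - se)³ = d³, so e = 0 or d² - sde + e² = 0. For e
  -- ≠ 0, α⁴ = μ⁴ gives d² + e² = 0, hence sde = 0, which is impossible.
  have hα : α = -μ := by
    have t2 : ((1 - s) * μ - (1 + s) * α) ^ 3 = (μ - α) ^ 3 := by
      field_simp at tri
      linear_combination -tri
    by_contra hne
    have hρ : μ + α ≠ 0 := fun h0 => hne (by linear_combination h0)
    have u1 : μ ^ 2 + α ^ 2 = 0 := by
      apply mul_left_cancel₀ (mul_ne_zero hσ hρ)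
      linear_combination -hα4
    have h3 : (3 : k) ≠ 0 := by norm_num
    have u2 : (μ - α) ^ 2 - s * (μ - α) * (μ + α) + (μ + α) ^ 2 = 0 := by
      apply mul_left_cancel₀ (mul_ne_zero (mul_ne_zero h3 s0) hρ)
      linear_combination -t2 - s * (μ + α) ^ 3 * hs
    have u3 : s * (μ - α) * (μ + α) = 0 := by linear_combination 2 * u1 - u2
    simp [s0, hσ, hρ] at u3
  subst hα
  have hn : 3 * s * μ ≠ 0 := mul_ne_zero (mul_ne_zero three_ne_zero s0) hμ
  -- `lin3` multiplies the Hesse forms with parameters 1 + s and 1 - s by -3s and 3s, while `g`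
  -- multiplies them by -μ and μ. The signs cancel in the product.
  obtain ⟨hT', hS'⟩ := pencil_scaled (lam := lam) (d := -(1 - s)) (c := 1) (α := 3 * s * μ)
    (g := g * lin3 hε) (by rw [h1]; intro h0; apply s0; linear_combination h0 / 2)
    (by
      intro v
      rw [LinearEquiv.mul_apply, hF, hesseForm_eq, hesseForm_eq, cubeSum_lin3, coordProd_lin3, h1]
      linear_combination 9 * μ * hs * coordProd v)
    (by
      intro v
      have := hC (lin3 hε v)
      rw [cubeSum_lin3, coordProd_lin3] at this
      rw [LinearEquiv.mul_apply]
      linear_combination this - 9 * μ * hs * coordProd v)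
  exact isHeisSwap_of_scaled hn hT' hS'

theorem scales_lin3 [CharZero k] {lam s a ε : k} (hs : s ^ 2 = 3) (h1 : lam = 1 + s)
    (hε : IsPrimitiveRoot ε 3) : Scales a a (lam * a) (lin3 hε) (3 * s) := by
  intro u v t
  have : 3 * s * form a a (lam * a) u v t
      = form (3 * s * a) (3 * s * a) (3 * s * (lam * a)) u v t := by
    simp only [form]; ring
  rw [this]
  refine form_polarization (fun v => ?_) u v t
  rw [form_self, form_self, cubeSum_lin3, coordProd_lin3, h1]
  linear_combination (-3 * a * cubeSum v) * hs

/-! ### Potentials as trilinear forms -/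

/-- The functional with the given coordinates in the dual basis. -/
abbrev functional (u : V3 k) : Module.Dual k (V3 k) := (Pi.basisFun k (Fin 3)).toDualEquiv u

theorem functional_apply (u x : V3 k) :
    functional u x = u 0 * x 0 + u 1 * x 1 + u 2 * x 2 := by
  have : functional u x = ∑ i, u i * x i := by
    rw [functional, Module.Basis.toDualEquiv_apply]
    conv_lhs => rw [← (Pi.basisFun k (Fin 3)).sum_repr u, ← (Pi.basisFun k (Fin 3)).sum_repr x]
    simp only [map_sum, map_smul, LinearMap.sum_apply, LinearMap.smul_apply,
      Module.Basis.toDual_apply]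
    simp [mul_comm]
  rw [this, Fin.sum_univ_three]

theorem functional_dualCoord (θ : V3 k ≃ₗ[k] V3 k) (u x : V3 k) :
    functional (dualCoord θ u) x = functional u (θ x) := by
  simp [functional, dualCoord]

/-- Evaluation of a potential at three functionals. -/
def evaluate (u v t : V3 k) : Potential k →ₗ[k] k :=
  LinearMap.mul' k k ∘ₗ TensorProduct.map
    (LinearMap.mul' k k ∘ₗ TensorProduct.map (functional u) (functional v)) (functional t)

theorem evaluate_mono3 (u v t x y z : V3 k) :
    evaluate u v t (mono3 x y z) = functional u x * functional v y * functional t z := rfl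

theorem evaluate_tensorCube (θ : V3 k ≃ₗ[k] V3 k) (u v t : V3 k) (w : Potential k) :
    evaluate u v t (tensorCube θ w)
      = evaluate (dualCoord θ u) (dualCoord θ v) (dualCoord θ t) w := by
  have : evaluate u v t ∘ₗ tensorCube θ
      = evaluate (dualCoord θ u) (dualCoord θ v) (dualCoord θ t) := by
    apply TensorProduct.ext_threefold
    intro x y z
    change functional u (θ x) * functional v (θ y) * functional t (θ z)
      = functional _ x * functional _ y * functional _ z
    simp only [functional_dualCoord]
  exact LinearMap.congr_fun this w

theorem evaluate_potential (a b c : k) (u v t : V3 k) :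
    evaluate u v t (potential a b c) = form a b c u v t := by
  simp only [potential, map_add, map_smul, evaluate_mono3, functional_apply]
  simp [bx, byy, bz, form]

theorem ext_evaluate {w w' : Potential k} (h : ∀ u v t, evaluate u v t w = evaluate u v t w') :
    w = w' := by
  let B := ((Pi.basisFun k (Fin 3)).tensorProduct (Pi.basisFun k (Fin 3))).tensorProduct
    (Pi.basisFun k (Fin 3))
  apply B.ext_elem
  rintro ⟨⟨i, j⟩, l⟩
  have key : ∀ w, B.repr w ((i, j), l)
      = evaluate (Pi.single i 1) (Pi.single j 1) (Pi.single l 1) w := by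
    intro w
    have : B.coord ((i, j), l)
        = evaluate (Pi.single i 1) (Pi.single j 1) (Pi.single l 1) := by
      apply TensorProduct.ext_threefold
      intro x y z
      change B.repr ((x ⊗ₜ[k] y) ⊗ₜ[k] z) ((i, j), l)
        = functional _ x * functional _ y * functional _ z
      have hf : ∀ (i : Fin 3) (x : V3 k), functional (Pi.single i 1) x = x i := by
        intro i x
        rw [functional_apply]
        fin_cases i <;> simp
      rw [hf, hf, hf]
      simp [B, mul_comm, mul_left_comm]
    exact LinearMap.congr_fun this w
  rw [key, key, h]

theorem mem_Aut_potential_iff (a b c : k) (θ : V3 k ≃ₗ[k] V3 k) :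
    θ ∈ Aut (potential a b c) ↔ ∃ μ, μ ≠ 0 ∧ Scales a b c (dualCoord θ) μ := by
  change (∃ μ : k, μ ≠ 0 ∧ tensorCube θ (potential a b c) = μ • potential a b c) ↔ _
  refine exists_congr fun μ => and_congr_right fun _ => ⟨fun h u v t => ?_, fun h => ?_⟩
  · rw [← evaluate_potential, ← evaluate_tensorCube, h, map_smul, evaluate_potential, smul_eq_mul]
  · refine ext_evaluate fun u v t => ?_
    rw [evaluate_tensorCube, evaluate_potential, h, map_smul, evaluate_potential, smul_eq_mul]

theorem functional_injective {u v : V3 k} (h : ∀ x, functional u x = functional v x) : u = v :=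
  (Pi.basisFun k (Fin 3)).toDualEquiv.injective (LinearMap.ext h)

/-- This reversal is why the natural action uses `θ⁻¹`. -/
theorem dualCoord_mul (θ η : V3 k ≃ₗ[k] V3 k) :
    dualCoord (θ * η) = dualCoord η * dualCoord θ := by
  ext1 u
  refine functional_injective fun x => ?_
  rw [LinearEquiv.mul_apply, functional_dualCoord, functional_dualCoord, functional_dualCoord]
  rfl

theorem dualCoord_dualCoord (θ : V3 k ≃ₗ[k] V3 k) : dualCoord (dualCoord θ) = θ := by
  ext1 u
  refine functional_injective fun x => ?_
  have comm : ∀ u x : V3 k, functional u x = functional x u := by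
    intro u x; rw [functional_apply, functional_apply]; ring
  rw [functional_dualCoord, comm, functional_dualCoord, comm]

/-! ### The natural action -/

theorem smul_eq_smul_of_forall {g h : V3 k ≃ₗ[k] V3 k} {κ : k} (H : ∀ v, g v = κ • h v)
    (P : ℙ k (V3 k)) : g • P = h • P := by
  induction P using Projectivization.ind with
  | h v hv =>
    rw [Projectivization.smul_mk, Projectivization.smul_mk, Projectivization.mk_eq_mk_iff']
    exact ⟨κ, (H v).symm⟩

/-- `σ` is the bijection of the curve induced by `g`. -/
def Induces {lam : k} (g : V3 k ≃ₗ[k] V3 k) (σ : Equiv.Perm (HesseCurve lam)) : Prop :=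
  ∀ q, (σ q).1 = g • q.1

theorem induces_restrict {lam : k} (g : V3 k ≃ₗ[k] V3 k)
    (h : ∀ v, hesseForm lam (g v) = 0 ↔ hesseForm lam v = 0) : Induces g (restrict lam g h) :=
  fun _ => rfl

theorem Induces.mul {lam : k} {g h : V3 k ≃ₗ[k] V3 k} {σ τ : Equiv.Perm (HesseCurve lam)}
    (hg : Induces g σ) (hh : Induces h τ) : Induces (g * h) (σ * τ) := fun q => by
  rw [Equiv.Perm.mul_apply, hg, hh, mul_smul]

theorem Induces.one {lam : k} : Induces (lam := lam) (1 : V3 k ≃ₗ[k] V3 k) 1 := fun q => by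
  rw [one_smul, Equiv.Perm.one_apply]

theorem Induces.inv {lam : k} {g : V3 k ≃ₗ[k] V3 k} {σ : Equiv.Perm (HesseCurve lam)}
    (hg : Induces g σ) : Induces g⁻¹ σ⁻¹ := fun q => by
  rw [eq_inv_smul_iff, ← hg]
  exact congrArg _ (σ.apply_symm_apply q)

theorem Induces.unique {lam : k} {g : V3 k ≃ₗ[k] V3 k} {σ τ : Equiv.Perm (HesseCurve lam)}
    (hσ : Induces g σ) (hτ : Induces g τ) : σ = τ :=
  Equiv.ext fun q => Subtype.ext (by rw [hσ, hτ])

/-- A projectivity fixing three distinct points of a line is the identity on it; these three are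
flexes of the curve on a coordinate line. -/
theorem eigen_pair {ε : k} (hε : IsPrimitiveRoot ε 3) {g : V3 k ≃ₗ[k] V3 k} {i j : Fin 3}
    (hij : i ≠ j)
    (h : ∀ ω : k, ω ^ 3 = 1 → ∃ κ : k,
      g (Pi.single i 1 - ω • Pi.single j 1) = κ • (Pi.single i 1 - ω • Pi.single j 1)) :
    ∃ κ : k, g (Pi.single i 1) = κ • Pi.single i 1 ∧ g (Pi.single j 1) = κ • Pi.single j 1 := by
  have h3 := hε.pow_eq_one
  have h1 : ε ≠ 1 := hε.ne_one (by norm_num)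
  have hs : ε ^ 2 + ε + 1 = 0 := by
    apply mul_left_cancel₀ (sub_ne_zero.2 h1)
    linear_combination h3
  have h0 : ε ≠ 0 := hε.ne_zero (by norm_num)
  obtain ⟨a, ha⟩ := h 1 (by ring)
  obtain ⟨b, hb⟩ := h ε h3
  obtain ⟨c, hc⟩ := h (ε ^ 2) (by linear_combination (ε ^ 3 + 1) * h3)
  simp only [map_sub, map_smul] at ha hb hc
  -- The eigenvectors for ω = 1, ε, ε² satisfy a linear relation with coefficients 1, ε, ε².
  -- Applying `g` to it gives a second relation, which makes the eigenvalues equal.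
  have comp : ∀ l, a * ((Pi.single i 1 : V3 k) l - (Pi.single j 1 : V3 k) l)
      + b * ε * ((Pi.single i 1 : V3 k) l - ε * (Pi.single j 1 : V3 k) l)
      + c * ε ^ 2 * ((Pi.single i 1 : V3 k) l - ε ^ 2 * (Pi.single j 1 : V3 k) l) = 0 := by
    intro l
    have ea := congrFun ha l
    have eb := congrFun hb l
    have ec := congrFun hc l
    simp only [Pi.sub_apply, Pi.smul_apply, smul_eq_mul, one_smul] at ea eb ec
    linear_combination -ea - ε * eb - ε ^ 2 * ec + hs * g (Pi.single i 1) l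
      - (hs + ε * h3) * g (Pi.single j 1) l
  have ci := comp i
  have cj := comp j
  rw [Pi.single_eq_same, Pi.single_eq_of_ne hij] at ci
  rw [Pi.single_eq_same, Pi.single_eq_of_ne hij.symm] at cj
  have hbc : b = c := by
    apply mul_left_cancel₀ (mul_ne_zero h0 (sub_ne_zero.2 h1))
    linear_combination -ci - cj - c * ε * h3
  have hab : a = b := by
    subst hbc
    linear_combination ci - b * hs
  subst hbc hab
  have hj : g (Pi.single j 1) = a • Pi.single j 1 := by
    ext l
    have ea := congrFun ha l
    have eb := congrFun hb l
    simp only [Pi.sub_apply, Pi.smul_apply, smul_eq_mul, one_smul] at ea eb ⊢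
    apply mul_left_cancel₀ (sub_ne_zero.2 h1)
    linear_combination ea - eb
  refine ⟨a, ?_, hj⟩
  rw [one_smul, hj, smul_sub, one_smul, sub_left_inj] at ha
  exact ha

theorem exists_eigenvalue {lam : k} {g : V3 k ≃ₗ[k] V3 k}
    (h : Induces (lam := lam) g 1) (v : V3 k) (hv0 : v ≠ 0) (hv : hesseForm lam v = 0) :
    ∃ κ : k, g v = κ • v := by
  have := h (HesseCurve.mk v hv0 hv)
  rw [Equiv.Perm.one_apply, HesseCurve.mk, Projectivization.smul_mk, eq_comm,
    Projectivization.mk_eq_mk_iff'] at this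
  obtain ⟨κ, hκ⟩ := this
  exact ⟨κ, hκ.symm⟩

/-- A linear automorphism that fixes the curve pointwise is a scalar. -/
theorem Induces.scalar {lam ε : k} (hε : IsPrimitiveRoot ε 3) {g : V3 k ≃ₗ[k] V3 k}
    (h : Induces (lam := lam) g 1) : ∃ κ : k, κ ≠ 0 ∧ ∀ v, g v = κ • v := by
  obtain ⟨κ, h0, h1⟩ := eigen_pair hε (i := 0) (j := 1) (g := g) (by decide) fun ω hω => by
    apply exists_eigenvalue h
    · intro hv
      simpa using congrFun hv 0
    · simp [hesseForm]; linear_combination -hω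
  obtain ⟨κ', h1', h2⟩ := eigen_pair hε (i := 1) (j := 2) (g := g) (by decide) fun ω hω => by
    apply exists_eigenvalue h
    · intro hv
      simpa using congrFun hv 1
    · simp [hesseForm]; linear_combination -hω
  have hκ : κ = κ' := by
    rw [h1] at h1'
    simpa using congrFun h1' 1
  subst hκ
  refine ⟨κ, ?_, fun v => ?_⟩
  · rintro rfl
    have : g (Pi.single 0 1) = g 0 := by rw [h0, zero_smul, map_zero]
    simpa using congrFun (g.injective this) 0
  · have hv : v = v 0 • Pi.single 0 1 + v 1 • Pi.single 1 1 + v 2 • Pi.single 2 1 := by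
      ext i; fin_cases i <;> simp
    rw [hv]
    simp only [map_add, map_smul, h0, h1, h2, smul_add]
    simp only [smul_comm κ]

theorem Aut.preserves {lam : k} {w : Potential k}
    (hres : ∀ θ ∈ Aut w, ∀ v, hesseForm lam (dualCoord θ v) = 0 ↔ hesseForm lam v = 0)
    (θ : Aut w) (v : V3 k) : hesseForm lam (dualCoord (θ.1⁻¹) v) = 0 ↔ hesseForm lam v = 0 :=
  hres _ ((Aut w).inv_mem θ.2) v

/-- The action of `Aut w` on a curve that is preserved by the contragredient maps. -/
def autHom {lam : k} {w : Potential k}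
    (hres : ∀ θ ∈ Aut w, ∀ v, hesseForm lam (dualCoord θ v) = 0 ↔ hesseForm lam v = 0) :
    Aut w →* Equiv.Perm (HesseCurve lam) :=
  MonoidHom.mk' (fun θ => restrict lam (dualCoord (θ.1⁻¹)) (Aut.preserves hres θ)) fun θ η => by
    apply Induces.unique (induces_restrict _ _)
    have : dualCoord ((θ * η : Aut w).1⁻¹) = dualCoord (θ.1⁻¹) * dualCoord (η.1⁻¹) := by
      rw [← dualCoord_mul, ← mul_inv_rev]; rfl
    rw [this]
    exact (induces_restrict _ _).mul (induces_restrict _ _)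

theorem pautEq_of_forall {lam ε : k} (hε : IsPrimitiveRoot ε 3) {w : Potential k}
    (hres : ∀ θ ∈ Aut w, ∀ v, hesseForm lam (dualCoord θ v) = 0 ↔ hesseForm lam v = 0)
    (G : Subgroup (Equiv.Perm (HesseCurve lam)))
    (h1 : ∀ θ ∈ Aut w, ∀ σ, Induces (dualCoord θ) σ → σ ∈ G)
    (h2 : G ≤ (autHom hres).range) : PAutEq w lam G := by
  refine ⟨QuotientGroup.lift _ (autHom hres) ?_, ?_, ?_, ?_⟩
  · rintro θ ⟨a, ha⟩
    refine Induces.unique (induces_restrict _ (Aut.preserves hres θ)) (fun q => ?_)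
    have : ∀ v, dualCoord (θ.1⁻¹) v = ((a⁻¹ : kˣ) : k) • (1 : V3 k ≃ₗ[k] V3 k) v := by
      intro v
      refine functional_injective fun x => ?_
      have hx : θ.1⁻¹ x = ((a⁻¹ : kˣ) : k) • x := by
        have : θ.1⁻¹ = DistribMulAction.toModuleAut k (V3 k) a⁻¹ := by
          rw [map_inv]; exact congrArg _ ha.symm
        rw [this]
        rfl
      rw [functional_dualCoord, hx]
      simp [functional]
    rw [smul_eq_smul_of_forall this, one_smul, Equiv.Perm.one_apply]
  · intro θ q
    rfl
  · rw [injective_iff_map_eq_one]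
    intro x
    induction x using QuotientGroup.induction_on with
    | H θ =>
      intro hx
      have hx : autHom hres θ = 1 := hx
      have hi : Induces (lam := lam) (dualCoord (θ.1⁻¹)) 1 := by
        rw [← hx]; exact induces_restrict _ (Aut.preserves hres θ)
      obtain ⟨κ, hκ, hs⟩ := hi.scalar hε
      rw [QuotientGroup.eq_one_iff, Subgroup.mem_subgroupOf]
      refine ⟨(Units.mk0 κ hκ)⁻¹, ?_⟩
      rw [map_inv, inv_eq_iff_eq_inv]
      ext1 x
      refine functional_injective fun y => ?_
      have comm : ∀ u x : V3 k, functional u x = functional x u := by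
        intro u x; rw [functional_apply, functional_apply]; ring
      have e : functional (θ.1⁻¹ x) y = functional (κ • y) x := by
        rw [comm, ← functional_dualCoord, hs]
      change functional (κ • x) y = functional (θ.1⁻¹ x) y
      rw [e, functional_apply, functional_apply]
      simp only [Pi.smul_apply, smul_eq_mul]
      ring
  · apply le_antisymm
    · rintro _ ⟨x, rfl⟩
      induction x using QuotientGroup.induction_on with
      | H θ => exact h1 _ ((Aut w).inv_mem θ.2) _ (induces_restrict _ (Aut.preserves hres θ))
    · intro σ hσ
      obtain ⟨θ, rfl⟩ := h2 hσ
      exact ⟨QuotientGroup.mk θ, rfl⟩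

theorem mem_range_autHom {lam a b c : k}
    (hres : ∀ θ ∈ Aut (potential a b c), ∀ v,
      hesseForm lam (dualCoord θ v) = 0 ↔ hesseForm lam v = 0)
    {g : V3 k ≃ₗ[k] V3 k} {μ : k} (hμ : μ ≠ 0) (hg : Scales a b c g μ)
    {σ : Equiv.Perm (HesseCurve lam)} (hσ : Induces g σ) : σ ∈ (autHom hres).range := by
  have hmem : dualCoord g ∈ Aut (potential a b c) :=
    (mem_Aut_potential_iff _ _ _ _).2 ⟨μ, hμ, by rwa [dualCoord_dualCoord]⟩
  refine ⟨⟨(dualCoord g)⁻¹, (Aut _).inv_mem hmem⟩, Induces.unique (g := g) (fun q => ?_) hσ⟩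
  change dualCoord ((dualCoord g)⁻¹⁻¹) • q.1 = _
  rw [inv_inv, dualCoord_dualCoord]

/-! ### The group law in coordinates -/

theorem addLaw1_smul (s t : k) (u v : V3 k) :
    addLaw1 (s • u) (t • v) = (s ^ 2 * t ^ 2) • addLaw1 u v := by
  ext i; fin_cases i <;> simp [addLaw1] <;> ring

theorem addLaw2_smul (s t : k) (u v : V3 k) :
    addLaw2 (s • u) (t • v) = (s ^ 2 * t ^ 2) • addLaw2 u v := by
  ext i; fin_cases i <;> simp [addLaw2] <;> ring

theorem exists_rep_eq {P : ℙ k (V3 k)} {u : V3 k} {hu : u ≠ 0}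
    (h : P = Projectivization.mk k u hu) : ∃ s : k, s ≠ 0 ∧ P.rep = s • u := by
  subst h
  obtain ⟨s, hs⟩ := Projectivization.exists_smul_eq_mk_rep k u hu
  exact ⟨s, s.ne_zero, hs.symm⟩

theorem add_eq_of_addLaw1 {lam : k} {p q : HesseCurve lam} {u v x : V3 k} {hu : u ≠ 0}
    {hv : v ≠ 0} (hx : x ≠ 0) (hp : p.1 = Projectivization.mk k u hu)
    (hq : q.1 = Projectivization.mk k v hv) {r : k} (hr : r ≠ 0) (h : addLaw1 u v = r • x) :
    (p + q).1 = Projectivization.mk k x hx := by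
  obtain ⟨s, hs, hs'⟩ := exists_rep_eq hp
  obtain ⟨t, ht, ht'⟩ := exists_rep_eq hq
  have e : addLaw1 p.1.rep q.1.rep = (s ^ 2 * t ^ 2 * r) • x := by
    rw [hs', ht', addLaw1_smul, h, smul_smul]
  have hne : s ^ 2 * t ^ 2 * r ≠ 0 := by positivity
  have h1 : addLaw1 p.1.rep q.1.rep ≠ 0 := by
    rw [e]; exact smul_ne_zero hne hx
  have : p + q = HesseCurve.mk (addLaw1 p.1.rep q.1.rep) h1 (hesseForm_addLaw1 p.2 q.2) :=
    dif_pos h1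
  rw [this, HesseCurve.mk, Projectivization.mk_eq_mk_iff']
  exact ⟨_, e.symm⟩

theorem add_eq_of_addLaw2 {lam : k} {p q : HesseCurve lam} {u v x : V3 k} {hu : u ≠ 0}
    {hv : v ≠ 0} (hx : x ≠ 0) (hp : p.1 = Projectivization.mk k u hu)
    (hq : q.1 = Projectivization.mk k v hv) {r : k} (hr : r ≠ 0) (h0 : addLaw1 u v = 0)
    (h : addLaw2 u v = r • x) :
    (p + q).1 = Projectivization.mk k x hx := by
  obtain ⟨s, hs, hs'⟩ := exists_rep_eq hp
  obtain ⟨t, ht, ht'⟩ := exists_rep_eq hq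
  have e : addLaw2 p.1.rep q.1.rep = (s ^ 2 * t ^ 2 * r) • x := by
    rw [hs', ht', addLaw2_smul, h, smul_smul]
  have h1 : ¬ addLaw1 p.1.rep q.1.rep ≠ 0 := by
    rw [hs', ht', addLaw1_smul, h0, smul_zero, not_not]
  have hne : s ^ 2 * t ^ 2 * r ≠ 0 := by positivity
  have h2 : addLaw2 p.1.rep q.1.rep ≠ 0 := by
    rw [e]; exact smul_ne_zero hne hx
  have : p + q = HesseCurve.mk (addLaw2 p.1.rep q.1.rep) h2 (hesseForm_addLaw2 p.2 q.2) :=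
    (dif_neg h1).trans (dif_pos h2)
  rw [this, HesseCurve.mk, Projectivization.mk_eq_mk_iff']
  exact ⟨_, e.symm⟩

theorem hesseForm_of_eq_mk {lam : k} {p : HesseCurve lam} {u : V3 k} {hu : u ≠ 0}
    (hp : p.1 = Projectivization.mk k u hu) : hesseForm lam u = 0 := by
  have := p.2
  rwa [hp, hesseForm_mk] at this

theorem HesseCurve.exists_rep {lam : k} (p : HesseCurve lam) :
    ∃ (u : V3 k) (hu : u ≠ 0), p.1 = Projectivization.mk k u hu ∧ hesseForm lam u = 0 :=
  ⟨p.1.rep, p.1.rep_nonzero, (Projectivization.mk_rep _).symm, p.2⟩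

/-- The coordinates of the zero element. -/
abbrev origin (k : Type*) [Field k] : V3 k := ![1, -1, 0]

theorem origin_ne_zero : origin k ≠ 0 := fun h => by simpa using congrFun h 0

theorem zero_val (lam : k) :
    (0 : HesseCurve lam).1 = Projectivization.mk k (origin k) origin_ne_zero := rfl

theorem ne_zero_coord {v : V3 k} (hv : v ≠ 0) : ¬ (v 0 = 0 ∧ v 1 = 0 ∧ v 2 = 0) := fun h => hv (by
  ext i; fin_cases i <;> simp [h])

theorem zero_add_curve {lam : k} (p : HesseCurve lam) : 0 + p = p := by
  obtain ⟨u, hu, hp, he⟩ := p.exists_rep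
  apply Subtype.ext
  rw [hp]
  have hu' := ne_zero_coord hu
  by_cases h2 : u 2 = 0
  · refine add_eq_of_addLaw2 hu (zero_val lam) hp (r := -u 0) ?_ ?_ ?_
    · simp only [hesseForm, h2] at he
      grind
    · ext i; fin_cases i <;> simp [addLaw1, h2]
    · ext i; fin_cases i <;> simp [addLaw2, h2]; ring
  · refine add_eq_of_addLaw1 hu (zero_val lam) hp (r := -u 2) (neg_ne_zero.2 h2) ?_
    ext i; fin_cases i <;> simp [addLaw1] <;> ring

/-- Addition of a flex is given by an element of the Heisenberg group. -/
theorem add_flex {lam ω : k} (hω : ω ^ 3 = 1) (j : Fin 3) {r : HesseCurve lam}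
    (hr : r.1 = heis hω j • (0 : HesseCurve lam).1) (q : HesseCurve lam) :
    (q + r).1 = heis hω j • q.1 := by
  obtain ⟨u, hu, hq, he⟩ := q.exists_rep
  rw [zero_val, Projectivization.smul_mk] at hr
  rw [hq, Projectivization.smul_mk]
  have hu' := ne_zero_coord hu
  have hω0 : ω ≠ 0 := by rintro rfl; norm_num at hω
  simp only [hesseForm] at he
  fin_cases j
  -- For each shift `j`, the first law gives a multiple of one coordinate of `u` times the
  -- Heisenberg image. It vanishes with that coordinate, and then the second law applies.
  · by_cases h : u 2 = 0
    · refine add_eq_of_addLaw2 _ hq hr (r := u 1) (by grind) ?_ ?_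
      · ext i; fin_cases i <;> simp [addLaw1, heis_apply, h]
      · ext i; fin_cases i <;> simp [addLaw2, heis_apply, h] <;> ring
    · refine add_eq_of_addLaw1 _ hq hr (r := ω ^ 2 * u 2) (by positivity) ?_
      ext i; fin_cases i <;> simp [addLaw1, heis_apply] <;> grind
  · by_cases h : u 1 = 0
    · refine add_eq_of_addLaw2 _ hq hr (r := u 0) (by grind) ?_ ?_
      · ext i; fin_cases i <;> simp [addLaw1, heis_apply, h]
      · ext i; fin_cases i <;> simp [addLaw2, heis_apply, h] <;> grind
    · refine add_eq_of_addLaw1 _ hq hr (r := ω ^ 2 * u 1) (by positivity) ?_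
      ext i; fin_cases i <;> simp [addLaw1, heis_apply] <;> grind
  · by_cases h : u 0 = 0
    · refine add_eq_of_addLaw2 _ hq hr (r := u 2) (by grind) ?_ ?_
      · ext i; fin_cases i <;> simp [addLaw1, heis_apply, h]
      · ext i; fin_cases i <;> simp [addLaw2, heis_apply, h] <;> grind
    · refine add_eq_of_addLaw1 _ hq hr (r := ω ^ 2 * u 0) (by positivity) ?_
      ext i; fin_cases i <;> simp [addLaw1, heis_apply] <;> grind

theorem addLaw1_self (u : V3 k) : addLaw1 u u = 0 := by
  ext i; fin_cases i <;> simp [addLaw1] <;> ring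

/-- A point of the curve whose coordinates have equal cubes would be singular. -/
theorem cubes_ne [CharZero k] {lam : k} (hl : lam ^ 3 ≠ 1) {u : V3 k} (hu : u ≠ 0)
    (he : hesseForm lam u = 0) : ¬ (u 0 ^ 3 = u 2 ^ 3 ∧ u 1 ^ 3 = u 2 ^ 3) := by
  rintro ⟨h1, h2⟩
  have h3 : (3 : k) ≠ 0 := by norm_num
  have h4 : u 2 ^ 3 = lam * u 0 * u 1 * u 2 := by
    apply mul_left_cancel₀ h3
    simp only [hesseForm] at he
    linear_combination he - h1 - h2
  have hu2 : u 2 ≠ 0 := by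
    intro h
    rw [h] at h1 h2
    exact ne_zero_coord hu ⟨by simpa using h1, by simpa using h2, h⟩
  apply hl
  apply mul_left_cancel₀ (pow_ne_zero 9 hu2)
  have : (u 2 ^ 3) ^ 3 = (lam * u 0 * u 1 * u 2) ^ 3 := by rw [← h4]
  have e : u 0 ^ 3 * u 1 ^ 3 = u 2 ^ 3 * u 2 ^ 3 := by rw [h1, h2]
  linear_combination -this - lam ^ 3 * u 2 ^ 3 * e

theorem double_val [CharZero k] {lam : k} (hl : lam ^ 3 ≠ 1) {p : HesseCurve lam} {u : V3 k}
    {hu : u ≠ 0} (hp : p.1 = Projectivization.mk k u hu) :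
    ∃ h : addLaw2 u u ≠ 0, (p + p).1 = Projectivization.mk k (addLaw2 u u) h := by
  have he := hesseForm_of_eq_mk hp
  have h := addLaw_ne_zero hl hu hu he he (addLaw1_self u)
  exact ⟨h, add_eq_of_addLaw2 h hp hp one_ne_zero (addLaw1_self u) (one_smul _ _).symm⟩

theorem mem_torsion_two [CharZero k] {lam : k} (hl : lam ^ 3 ≠ 1) {p : HesseCurve lam} {u : V3 k}
    {hu : u ≠ 0} (hp : p.1 = Projectivization.mk k u hu) (h0 : u 0 ≠ 0) (h1 : u 1 ≠ 0)
    (h2 : u 2 ≠ 0) : p ∈ torsion lam 2 ↔ u 0 = u 1 := by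
  -- Associativity is never needed: multiples are the unfolded left-nested sums starting from 0.
  change (0 + p) + p = 0 ↔ _
  obtain ⟨hd, hdv⟩ := double_val hl hp
  have hc := cubes_ne hl hu (hesseForm_of_eq_mk hp)
  rw [zero_add_curve, Subtype.ext_iff, hdv, zero_val, Projectivization.mk_eq_mk_iff']
  constructor
  · rintro ⟨t, ht⟩
    have e0 := congrFun ht 0
    have e1 := congrFun ht 1
    have e2 := congrFun ht 2
    simp [addLaw2] at e0 e1 e2
    grind
  · intro h
    refine ⟨u 0 * (u 0 ^ 3 - u 2 ^ 3), ?_⟩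
    ext i; fin_cases i <;> simp [addLaw2, ← h] <;> ring

theorem not_mem_torsion_three [CharZero k] {lam : k} (hl : lam ^ 3 ≠ 1) {p : HesseCurve lam}
    {u : V3 k} {hu : u ≠ 0} (hp : p.1 = Projectivization.mk k u hu) (h0 : u 0 ≠ 0) (h1 : u 1 ≠ 0)
    (h2 : u 2 ≠ 0) : p ∉ torsion lam 3 := by
  change ¬ ((0 + p) + p) + p = 0
  obtain ⟨hd, hdv⟩ := double_val hl hp
  have he := hesseForm_of_eq_mk hp
  have hde : hesseForm lam (addLaw2 u u) = 0 := hesseForm_of_eq_mk hdv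
  have hc := cubes_ne hl hu he
  rw [zero_add_curve, Subtype.ext_iff, zero_val]
  -- In these variables the last coordinate of 3p, under either addition law, is a nonzero multiple
  -- of x² + xy + y². If 3p is zero, this vanishes and the first two coordinates add up to 0;
  -- together these give x = y, so 3x² = 0.
  obtain ⟨x, y, hx, hy⟩ : ∃ x y : k, u 0 ^ 3 = u 2 ^ 3 + x ∧ u 1 ^ 3 = u 2 ^ 3 - y :=
    ⟨u 0 ^ 3 - u 2 ^ 3, u 2 ^ 3 - u 1 ^ 3, by ring, by ring⟩
  have hD : addLaw2 u u = ![u 1 * x, u 0 * y, -u 2 * (x + y)] := by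
    ext i; fin_cases i <;> simp [addLaw2] <;> grind
  rw [hx, hy] at hc
  have fin : x ^ 2 + x * y + y ^ 2 = 0 → x ≠ 0 := by
    rintro h rfl
    apply hc
    simp at h
    simp [h]
  by_cases hz : addLaw1 (addLaw2 u u) u = 0
  · have hne := addLaw_ne_zero hl hd hu hde he hz
    rw [add_eq_of_addLaw2 hne hdv hp one_ne_zero hz (one_smul _ _).symm,
      Projectivization.mk_eq_mk_iff']
    rintro ⟨t, ht⟩
    rw [hD] at ht
    have e0 := congrFun ht 0
    have e1 := congrFun ht 1
    have e2 := congrFun ht 2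
    simp [addLaw2] at e0 e1 e2
    have q : x ^ 2 + x * y + y ^ 2 = 0 := by
      apply mul_left_cancel₀ (mul_ne_zero (mul_ne_zero h0 (pow_ne_zero 2 h1)) h2)
      linear_combination e2
    have hx0 := fin q
    have e3 : x * y * (x - y) = 0 := by
      apply mul_left_cancel₀ h1
      linear_combination -e0 - e1 - u 1 * y * (x - y) * hx + 2 * u 1 * u 2 ^ 3 * q
    have hy0 : y ≠ 0 := by
      rintro rfl
      simp [hx0] at q
    have hxy : x = y := by simpa [hx0, hy0, sub_eq_zero] using e3
    subst hxy
    have : 3 * x ^ 2 = 0 := by linear_combination q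
    simp [hx0] at this
  · rw [add_eq_of_addLaw1 hz hdv hp one_ne_zero (one_smul _ _).symm,
      Projectivization.mk_eq_mk_iff']
    rintro ⟨t, ht⟩
    rw [hD] at ht hz
    have e0 := congrFun ht 0
    have e1 := congrFun ht 1
    have e2 := congrFun ht 2
    simp [addLaw1] at e0 e1 e2
    have q : x ^ 2 + x * y + y ^ 2 = 0 := by
      apply mul_left_cancel₀ (mul_ne_zero (mul_ne_zero h0 h1) (pow_ne_zero 2 h2))
      linear_combination e2
    have hx0 := fin q
    have hxy : x + y ≠ 0 := by
      intro h
      apply pow_ne_zero 2 hx0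
      linear_combination q - y * h
    have hcube : u 0 ^ 3 ≠ u 1 ^ 3 := fun h => hxy (by linear_combination h - hx + hy)
    have e3 : (u 0 ^ 3 - u 1 ^ 3) * (x + y) * (x - y) = 0 := by
      apply mul_left_cancel₀ h2
      linear_combination -e0 - e1 + u 2 * (u 1 ^ 3 + u 0 ^ 3) * q
    have hxy' : x = y := by
      simpa [sub_eq_zero, hcube, hxy] using e3
    subst hxy'
    have : 3 * x ^ 2 = 0 := by linear_combination q
    simp [hx0] at this

theorem exists_heis_of_coordProd {lam : k} {r : HesseCurve lam} {u : V3 k} {hu : u ≠ 0}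
    (hr : r.1 = Projectivization.mk k u hu) (h : coordProd u = 0) :
    ∃ (ω : k) (hω : ω ^ 3 = 1) (j : Fin 3), r.1 = heis hω j • (0 : HesseCurve lam).1 := by
  have he := hesseForm_of_eq_mk hr
  have hu' := ne_zero_coord hu
  rw [hr]
  simp only [zero_val, Projectivization.smul_mk, Projectivization.mk_eq_mk_iff']
  simp only [hesseForm] at he
  by_cases h0 : u 0 = 0
  · have h1 : u 1 ≠ 0 := by grind
    refine ⟨-u 2 / u 1, ?_, 2, -u 1 ^ 2 / u 2, ?_⟩
    · field_simp; grind
    · ext i; fin_cases i <;> simp [heis_apply, h0] <;> grind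
  by_cases h1 : u 1 = 0
  · refine ⟨-u 0 / u 2, ?_, 1, -u 0, ?_⟩
    · grind
    · ext i; fin_cases i <;> simp [heis_apply, h1]; grind
  have h2 : u 2 = 0 := by simpa [coordProd, h0, h1] using h
  refine ⟨-u 1 / u 0, ?_, 0, u 0, ?_⟩
  · grind
  · ext i; fin_cases i <;> simp [heis_apply, h2]; grind

theorem mem_torsion_three [CharZero k] {lam : k} (hl : lam ^ 3 ≠ 1) (r : HesseCurve lam) :
    r ∈ torsion lam 3 ↔
      ∃ (ω : k) (hω : ω ^ 3 = 1) (j : Fin 3), r.1 = heis hω j • (0 : HesseCurve lam).1 := by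
  constructor
  · intro h
    obtain ⟨u, hu, hr, he⟩ := r.exists_rep
    refine exists_heis_of_coordProd hr ?_
    by_contra hne
    simp only [coordProd, mul_eq_zero, not_or] at hne
    exact not_mem_torsion_three hl hr hne.1.1 hne.1.2 hne.2 h
  · rintro ⟨ω, hω, j, hr⟩
    change ((0 + r) + r) + r = 0
    apply Subtype.ext
    rw [add_flex hω j hr, add_flex hω j hr, add_flex hω j hr, ← mul_smul, ← mul_smul]
    conv_rhs => rw [← one_smul (V3 k ≃ₗ[k] V3 k) (0 : HesseCurve lam).1]
    refine smul_eq_smul_of_forall (κ := 1) (fun v => ?_) _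
    ext i
    fin_cases j <;> fin_cases i <;> simp [heis_apply] <;> grind

/-! ### The translations by the flexes -/

theorem heis_heis {ω ω' : k} (hω : ω ^ 3 = 1) (hω' : ω' ^ 3 = 1) (j j' : Fin 3) (v : V3 k) :
    heis hω j (heis hω' j' v)
      = ω' ^ (j : ℕ) • heis (ω := ω * ω') (by rw [mul_pow, hω, hω', one_mul]) (j + j') v := by
  ext i
  simp only [heis_apply, Pi.smul_apply, smul_eq_mul, add_assoc]
  have : ω' ^ ((i + j : Fin 3) : ℕ) = ω' ^ (j : ℕ) * ω' ^ (i : ℕ) := by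
    rw [← pow_add, add_comm (j : ℕ), Fin.val_add]
    conv_rhs => rw [← Nat.div_add_mod (i + j : ℕ) 3, pow_add, pow_mul, hω', one_pow, one_mul]
  rw [this, mul_pow]
  ring

theorem IsHeis.of_smul {g h : V3 k ≃ₗ[k] V3 k} (hh : IsHeis h) {κ : k} (hκ : κ ≠ 0)
    (H : ∀ v, g v = κ • h v) : IsHeis g := by
  obtain ⟨ω, hω, j, κ', hκ', h'⟩ := hh
  exact ⟨ω, hω, j, κ * κ', mul_ne_zero hκ hκ', fun v => by rw [H, h', smul_smul]⟩

theorem isHeis_heis {ω : k} (hω : ω ^ 3 = 1) (j : Fin 3) : IsHeis (heis hω j) :=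
  ⟨ω, hω, j, 1, one_ne_zero, fun _ => (one_smul _ _).symm⟩

theorem heis_one (h : (1 : k) ^ 3 = 1) (v : V3 k) : heis h 0 v = v := by
  ext i
  rw [heis_apply, one_pow, one_mul, add_zero]

theorem isHeis_one : IsHeis (1 : V3 k ≃ₗ[k] V3 k) :=
  ⟨1, one_pow 3, 0, 1, one_ne_zero, fun v => by rw [heis_one, one_smul]; rfl⟩

theorem IsHeis.mul {g h : V3 k ≃ₗ[k] V3 k} (hg : IsHeis g) (hh : IsHeis h) : IsHeis (g * h) := by
  obtain ⟨ω, hω, j, κ, hκ, hg⟩ := hg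
  obtain ⟨ω', hω', j', κ', hκ', hh⟩ := hh
  have hω0 : ω' ≠ 0 := by rintro rfl; norm_num at hω'
  refine ⟨ω * ω', by rw [mul_pow, hω, hω', one_mul], j + j', κ * κ' * ω' ^ (j : ℕ),
    by positivity, fun v => ?_⟩
  rw [LinearEquiv.mul_apply, hg, hh, map_smul, heis_heis, smul_smul, smul_smul]

theorem IsHeis.inv {g : V3 k ≃ₗ[k] V3 k} (hg : IsHeis g) : IsHeis g⁻¹ := by
  obtain ⟨ω, hω, j, κ, hκ, hg⟩ := hg
  have hω0 : ω ≠ 0 := by rintro rfl; norm_num at hω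
  have hω2 : (ω ^ 2) ^ 3 = 1 := by linear_combination (ω ^ 3 + 1) * hω
  refine ⟨ω ^ 2, hω2, -j, κ⁻¹ * ω ^ (j : ℕ), by positivity, fun v => ?_⟩
  have hgg : g (g⁻¹ v) = v := g.apply_symm_apply v
  apply g.injective
  rw [hgg, map_smul, hg, heis_heis, smul_smul, smul_smul]
  have e1 : κ⁻¹ * ω ^ (j : ℕ) * κ * (ω ^ 2) ^ (j : ℕ) = 1 := by
    calc _ = κ⁻¹ * κ * (ω ^ 3) ^ (j : ℕ) := by ring
      _ = 1 := by rw [hω, one_pow, mul_one, inv_mul_cancel₀ hκ]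
  rw [e1, one_smul]
  ext i
  rw [heis_apply, add_neg_cancel, add_zero, show ω * ω ^ 2 = 1 by linear_combination hω, one_pow,
    one_mul]

/-- The group of bijections of the curve induced by the Heisenberg group. -/
def heisPerm (lam : k) : Subgroup (Equiv.Perm (HesseCurve lam)) where
  carrier := {σ | ∃ g, IsHeis g ∧ Induces g σ}
  one_mem' := ⟨1, isHeis_one, Induces.one⟩
  mul_mem' := by
    rintro σ τ ⟨g, hg, hσ⟩ ⟨h, hh, hτ⟩
    exact ⟨g * h, hg.mul hh, hσ.mul hτ⟩
  inv_mem' := by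
    rintro σ ⟨g, hg, hσ⟩
    exact ⟨g⁻¹, hg.inv, hσ.inv⟩

theorem hesseForm_heis {ω : k} (hω : ω ^ 3 = 1) (j : Fin 3) (lam : k) (v : V3 k) :
    hesseForm lam (heis hω j v) = hesseForm lam v := by
  fin_cases j <;> simp [hesseForm, heis_apply] <;> grind

theorem isTranslationGroup_heisPerm [CharZero k] {lam : k} (hl : lam ^ 3 ≠ 1) :
    IsTranslationGroup lam 3 (heisPerm lam) := by
  ext f
  constructor
  · rintro ⟨σ, ⟨g, ⟨ω, hω, j, κ, hκ, hg⟩, hσ⟩, rfl⟩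
    have h : ∀ q, (σ q).1 = heis hω j • q.1 := fun q => by
      rw [hσ, smul_eq_smul_of_forall hg]
    refine ⟨σ 0, (mem_torsion_three hl _).2 ⟨ω, hω, j, h 0⟩, funext fun q => Subtype.ext ?_⟩
    exact (add_flex hω j (h 0) q).trans (h q).symm
  · rintro ⟨r, hr, rfl⟩
    obtain ⟨ω, hω, j, hr⟩ := (mem_torsion_three hl r).1 hr
    refine ⟨restrict lam (heis hω j) (fun v => by rw [hesseForm_heis]),
      ⟨_, isHeis_heis hω j, induces_restrict _ _⟩, funext fun q => Subtype.ext ?_⟩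
    exact (add_flex hω j hr q).symm

theorem eq_one_of_mem_heisPerm {lam : k} {σ : Equiv.Perm (HesseCurve lam)}
    (hσ : σ ∈ heisPerm lam) (h0 : σ 0 = 0) : σ = 1 := by
  obtain ⟨g, ⟨ω, hω, j, κ, hκ, hg⟩, hi⟩ := hσ
  have h : ∀ q, (σ q).1 = heis hω j • q.1 := fun q => by
    rw [hi, smul_eq_smul_of_forall hg]
  have h1 := h 0
  rw [h0, zero_val, Projectivization.smul_mk, Projectivization.mk_eq_mk_iff'] at h1
  obtain ⟨t, ht⟩ := h1
  have e0 := congrFun ht 0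
  have e1 := congrFun ht 1
  have e2 := congrFun ht 2
  have hω0 : ω ≠ 0 := by rintro rfl; norm_num at hω
  have : j = 0 ∧ ω = 1 := by
    fin_cases j <;> simp [heis_apply] at e0 e1 e2 ⊢
    rw [e0, one_mul] at e1; exact e1
  obtain ⟨rfl, rfl⟩ := this
  ext1 q
  apply Subtype.ext
  rw [h, smul_eq_smul_of_forall (h := 1) (κ := 1) (fun v => by rw [heis_one, one_smul]; rfl),
    one_smul, Equiv.Perm.one_apply]

theorem isSemidirect_heisPerm {lam : k} {l : V3 k ≃ₗ[k] V3 k} {τ : Equiv.Perm (HesseCurve lam)}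
    (hτ : Induces l τ) (h4 : τ ^ 4 = 1) (h0 : τ 0 = 0)
    (hl : ∀ g, IsHeis g → ∃ h, IsHeis h ∧ ∀ v, l (g v) = h (l v)) :
    IsSemidirect (heisPerm lam ⊔ Subgroup.zpowers τ) (heisPerm lam) (Subgroup.zpowers τ) := by
  have conj : ∀ σ ∈ heisPerm lam, τ * σ * τ⁻¹ ∈ heisPerm lam := by
    rintro σ ⟨g, hg, hσ⟩
    obtain ⟨h, hh, e⟩ := hl g hg
    refine ⟨h, hh, ?_⟩
    have : h = l * g * l⁻¹ := by
      ext1 v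
      have hv : l (l⁻¹ v) = v := l.apply_symm_apply v
      rw [LinearEquiv.mul_apply, LinearEquiv.mul_apply, e, hv]
    rw [this]
    exact (hτ.mul hσ).mul hτ.inv
  refine ⟨rfl, ?_, ?_⟩
  · rw [Subgroup.zpowers_le, Subgroup.mem_normalizer_iff]
    -- As τ⁴ = 1, conjugation by τ⁻¹ is conjugation by τ three times.
    refine fun σ => ⟨conj σ, fun h => ?_⟩
    have h' := conj _ (conj _ (conj _ h))
    have e : τ * (τ * (τ * (τ * σ * τ⁻¹) * τ⁻¹) * τ⁻¹) * τ⁻¹ = τ ^ 4 * σ * (τ ^ 4)⁻¹ := by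
      simp only [pow_succ, pow_zero, one_mul, mul_inv_rev, mul_assoc]
    rwa [e, h4, one_mul, inv_one, mul_one] at h'
  · rw [eq_bot_iff]
    rintro σ ⟨hσ, hz⟩
    rw [Subgroup.mem_bot]
    refine eq_one_of_mem_heisPerm hσ ?_
    have hle : Subgroup.zpowers τ ≤ MulAction.stabilizer (Equiv.Perm (HesseCurve lam))
        (0 : HesseCurve lam) := by
      rw [Subgroup.zpowers_le]
      exact h0
    exact hle hz

/-! ### Normalization of the Heisenberg group -/

theorem lin1_heis {g : V3 k ≃ₗ[k] V3 k} (hg : IsHeis g) :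
    ∃ h, IsHeis h ∧ ∀ v, lin1 k (g v) = h (lin1 k v) := by
  obtain ⟨ω, hω, j, κ, hκ, hg⟩ := hg
  have hω0 : ω ≠ 0 := by rintro rfl; norm_num at hω
  have hω2 : (ω ^ 2) ^ 3 = 1 := by linear_combination (ω ^ 3 + 1) * hω
  -- The transposition acts on indices by i ↦ 1 - i mod 3, so it inverts both ω and the shift, with
  -- ω as the correcting scalar.
  refine ⟨lin1 k * g * lin1 k, ⟨ω ^ 2, hω2, 2 * j, κ * ω, mul_ne_zero hκ hω0, fun v => ?_⟩,
    fun v => ?_⟩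
  · rw [LinearEquiv.mul_apply, LinearEquiv.mul_apply, hg]
    ext i
    fin_cases j <;> fin_cases i <;> simp [lin1, heis_apply] <;> grind
  · rw [LinearEquiv.mul_apply, LinearEquiv.mul_apply, lin1_lin1]

theorem lin3_heis [CharZero k] {ε : k} (hε : IsPrimitiveRoot ε 3) {g : V3 k ≃ₗ[k] V3 k}
    (hg : IsHeis g) : ∃ h, IsHeis h ∧ ∀ v, lin3 hε (g v) = h (lin3 hε v) := by
  obtain ⟨ω, hω, j, κ, hκ, hg⟩ := hg
  have h3 := hε.pow_eq_one
  have hε0 : ε ≠ 0 := hε.ne_zero (by norm_num)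
  obtain ⟨n, hn, rfl⟩ := hε.eq_pow_of_pow_eq_one hω
  have hj : (ε ^ (j : ℕ)) ^ 3 = 1 := by rw [← pow_mul, mul_comm, pow_mul, h3, one_pow]
  -- The Fourier transform exchanges shifts and characters: the shift `j` becomes the character ε^j,
  -- and the character εⁿ becomes the shift by -n = 2n mod 3.
  have key : ∀ v, lin3 hε (g v)
      = (κ * ε ^ ((j : ℕ) + 2 * n * (1 + j))) • heis hj (Fin.ofNat 3 (2 * n)) (lin3 hε v) := by
    intro v
    rw [hg]
    ext i
    clear hg
    interval_cases n <;> fin_cases j <;> fin_cases i <;> simp [lin3, heis_apply] <;> grind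
  refine ⟨lin3 hε * g * (lin3 hε)⁻¹, ⟨_, hj, Fin.ofNat 3 (2 * n), κ * ε ^ ((j : ℕ) + 2 * n * (1 + j)),
    mul_ne_zero hκ (pow_ne_zero _ hε0), fun v => ?_⟩, fun v => ?_⟩
  · have hv : lin3 hε ((lin3 hε)⁻¹ v) = v := (lin3 hε).apply_symm_apply v
    rw [LinearEquiv.mul_apply, LinearEquiv.mul_apply, key, hv]
  · have hv : (lin3 hε)⁻¹ (lin3 hε v) = v := (lin3 hε).symm_apply_apply v
    rw [LinearEquiv.mul_apply, LinearEquiv.mul_apply, hv]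

/-- The entries of `lin3` are ε^(2(i+1)(l+1)): it is a Fourier transform in the index l + 1, and its
square is 3 times the reflection of this index. -/
theorem lin3_lin3 [CharZero k] {ε : k} (hε : IsPrimitiveRoot ε 3) (v : V3 k) :
    lin3 hε (lin3 hε v) = (3 : k) • lin1 k v := by
  have h : ε ^ 2 + ε + 1 = 0 := by
    have := hε.geom_sum_eq_zero (by norm_num)
    simp only [Finset.sum_range_succ, Finset.sum_range_zero] at this
    linear_combination this
  ext i
  fin_cases i <;> simp [lin3, lin1] <;> grind

theorem induces_tau1 (lam : k) : Induces (lin1 k) (tau1 lam) := induces_restrict _ _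

theorem tau1_sq (lam : k) : tau1 lam ^ 2 = 1 := by
  rw [pow_two]
  refine Induces.unique ((induces_tau1 lam).mul (induces_tau1 lam)) (fun q => ?_)
  rw [smul_eq_smul_of_forall (h := 1) (κ := 1) (fun v => ?_), one_smul, Equiv.Perm.one_apply]
  rw [LinearEquiv.mul_apply, lin1_lin1, one_smul]; rfl

theorem tau2_cube {lam ε : k} (hlam : lam = 0) (hε : IsPrimitiveRoot ε 3) :
    tau2 hlam hε ^ 3 = tau1 lam := by
  have h2 : Induces (lin2 hε) (tau2 hlam hε) := induces_restrict _ _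
  rw [pow_succ, pow_two]
  refine Induces.unique ((h2.mul h2).mul h2) (fun q => ?_)
  rw [induces_tau1, smul_eq_smul_of_forall (g := lin1 k) (κ := 1)]
  intro v
  have h3 := hε.pow_eq_one
  ext i
  fin_cases i <;> simp [lin1, lin2]
  linear_combination -v 2 * h3

section

variable [CharZero k] {lam s ε : k} (hs : s ^ 2 = 3) (hlam : lam = 1 + s)
  (hε : IsPrimitiveRoot ε 3)

theorem induces_tau3 : Induces (lin3 hε) (tau3 hs hlam hε) := induces_restrict _ _

theorem tau3_sq : tau3 hs hlam hε ^ 2 = tau1 lam := by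
  rw [pow_two]
  refine Induces.unique ((induces_tau3 hs hlam hε).mul (induces_tau3 hs hlam hε)) (fun q => ?_)
  rw [induces_tau1, smul_eq_smul_of_forall (h := lin3 hε * lin3 hε) (κ := 3⁻¹)]
  intro v
  rw [LinearEquiv.mul_apply, lin3_lin3, smul_smul, inv_mul_cancel₀ three_ne_zero, one_smul]

theorem tau3_zero : tau3 hs hlam hε 0 = 0 := by
  apply Subtype.ext
  rw [induces_tau3, zero_val, Projectivization.smul_mk, Projectivization.mk_eq_mk_iff']
  refine ⟨ε ^ 2 - ε, ?_⟩
  ext i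
  fin_cases i <;> simp [lin3] <;> ring

end

theorem tau1_zero (lam : k) : tau1 lam 0 = 0 := by
  apply Subtype.ext
  rw [induces_tau1, zero_val, Projectivization.smul_mk, Projectivization.mk_eq_mk_iff']
  refine ⟨-1, ?_⟩
  ext i
  fin_cases i <;> simp [lin1]

theorem isSemidirect_tau1 (lam : k) :
    IsSemidirect (heisPerm lam ⊔ Subgroup.zpowers (tau1 lam)) (heisPerm lam)
      (Subgroup.zpowers (tau1 lam)) :=
  isSemidirect_heisPerm (induces_tau1 lam)
    (by rw [show 4 = 2 * 2 from rfl, pow_mul, tau1_sq, one_pow]) (tau1_zero lam)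
    fun _ => lin1_heis

theorem isSemidirect_tau3 [CharZero k] {lam s ε : k} (hs : s ^ 2 = 3) (hlam : lam = 1 + s)
    (hε : IsPrimitiveRoot ε 3) :
    IsSemidirect (heisPerm lam ⊔ Subgroup.zpowers (tau3 hs hlam hε)) (heisPerm lam)
      (Subgroup.zpowers (tau3 hs hlam hε)) :=
  isSemidirect_heisPerm (induces_tau3 hs hlam hε)
    (by rw [show 4 = 2 * 2 from rfl, pow_mul, tau3_sq, tau1_sq]) (tau3_zero hs hlam hε)
    fun _ => lin3_heis hε

/-! ### The projective automorphism groups -/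

theorem Induces.pow {lam : k} {g : V3 k ≃ₗ[k] V3 k} {σ : Equiv.Perm (HesseCurve lam)} (h : Induces g σ)
    (n : ℕ) : Induces (g ^ n) (σ ^ n) := by
  induction n with
  | zero => simpa using Induces.one
  | succ n ih => rw [pow_succ, pow_succ]; exact ih.mul h

section

variable {lam a b c : k}

theorem IsHeis.scales {g : V3 k ≃ₗ[k] V3 k} (hg : IsHeis g) (a b c : k) :
    ∃ μ, μ ≠ 0 ∧ Scales a b c g μ := by
  obtain ⟨ω, hω, j, κ, hκ, hg⟩ := hg
  refine ⟨κ ^ 3, pow_ne_zero 3 hκ, fun u v t => ?_⟩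
  rw [hg, hg, hg, ← form_heis a b c hω j u v t]
  simp only [form, Pi.smul_apply, smul_eq_mul]
  ring

variable [CharZero k]

theorem preserves_hesseForm (ha : a ≠ 0) (hb : b ≠ 0) (hc : c ≠ 0)
    (he : a ^ 3 + b ^ 3 + c ^ 3 = 3 * lam * a * b * c) (θ : V3 k ≃ₗ[k] V3 k)
    (hθ : θ ∈ Aut (potential a b c)) (v : V3 k) :
    hesseForm lam (dualCoord θ v) = 0 ↔ hesseForm lam v = 0 := by
  obtain ⟨μ, hμ, h⟩ := (mem_Aut_potential_iff _ _ _ _).1 hθ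
  rw [h.hesseForm ha hb hc he, mul_eq_zero, or_iff_right]
  exact div_ne_zero (pow_ne_zero 3 hμ) (pow_ne_zero 2 (gdet_ne_zero _))

theorem pautEq_heisPerm {ε : k} (hε : IsPrimitiveRoot ε 3) (hl : lam ^ 3 ≠ 1) (ha : a ≠ 0)
    (hb : b ≠ 0) (hc : c ≠ 0) (he : a ^ 3 + b ^ 3 + c ^ 3 = 3 * lam * a * b * c) (hab : a ≠ b) :
    PAutEq (potential a b c) lam (heisPerm lam) := by
  refine pautEq_of_forall hε (preserves_hesseForm ha hb hc he) _ ?_ ?_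
  · intro θ hθ σ hσ
    obtain ⟨μ, hμ, h⟩ := (mem_Aut_potential_iff _ _ _ _).1 hθ
    exact ⟨_, h.isHeis hl ha hb hc he hab, hσ⟩
  · rintro σ ⟨g, hg, hσ⟩
    obtain ⟨μ, hμ, h⟩ := hg.scales a b c
    exact mem_range_autHom _ hμ h hσ

theorem pautEqSemidirect_of_forall {ε : k} (hε : IsPrimitiveRoot ε 3) (ha : a ≠ 0) (hb : b ≠ 0)
    (hc : c ≠ 0) (he : a ^ 3 + b ^ 3 + c ^ 3 = 3 * lam * a * b * c)
    {l : V3 k ≃ₗ[k] V3 k} {τ : Equiv.Perm (HesseCurve lam)} (hτ : Induces l τ)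
    (hsemi : IsSemidirect (heisPerm lam ⊔ Subgroup.zpowers τ) (heisPerm lam)
      (Subgroup.zpowers τ))
    {ν : k} (hν : ν ≠ 0) (hl : Scales a b c l ν)
    (hclass : ∀ g μ, μ ≠ 0 → Scales a b c g μ → ∃ n : ℕ, IsHeis (g * l ^ n)) :
    PAutEqSemidirect (potential a b c) lam (heisPerm lam) (Subgroup.zpowers τ) := by
  refine ⟨_, hsemi, pautEq_of_forall hε (preserves_hesseForm ha hb hc he) _ ?_ ?_⟩
  · intro θ hθ σ hσ
    obtain ⟨μ, hμ, h⟩ := (mem_Aut_potential_iff _ _ _ _).1 hθ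
    obtain ⟨n, hn⟩ := hclass _ μ hμ h
    have h1 : σ * τ ^ n ∈ heisPerm lam := ⟨_, hn, hσ.mul (hτ.pow n)⟩
    have h2 : τ ^ n ∈ Subgroup.zpowers τ := Subgroup.npow_mem_zpowers τ n
    rw [← mul_inv_cancel_right σ (τ ^ n)]
    exact mul_mem (Subgroup.mem_sup_left h1) (inv_mem (Subgroup.mem_sup_right h2))
  · rw [sup_le_iff, Subgroup.zpowers_le]
    constructor
    · rintro σ ⟨g, hg, hσ⟩
      obtain ⟨μ, hμ, h⟩ := hg.scales a b c
      exact mem_range_autHom _ hμ h hσ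
    · exact mem_range_autHom _ hν hl hτ

theorem pautEqSemidirect_tau1 {ε : k} (hε : IsPrimitiveRoot ε 3) (hl : lam ^ 3 ≠ 1) (ha : a ≠ 0)
    (hc : c ≠ 0) (he : a ^ 3 + a ^ 3 + c ^ 3 = 3 * lam * a * a * c)
    (hH : c * (4 - lam ^ 3) ≠ -6 * lam ^ 2 * a) :
    PAutEqSemidirect (potential a a c) lam (heisPerm lam) (Subgroup.zpowers (tau1 lam)) := by
  refine pautEqSemidirect_of_forall hε ha ha hc he (induces_tau1 lam) (isSemidirect_tau1 lam)
    one_ne_zero (fun u v t => by rw [form_lin1, one_mul]) ?_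
  intro g μ hμ h
  rcases h.isHeisSwap_or hμ hl ha hc he with (h1 | h1) | ⟨h1, -⟩
  · exact ⟨0, by rwa [pow_zero, mul_one]⟩
  · exact ⟨1, by rwa [pow_one]⟩
  · exact absurd h1 hH

theorem pautEqSemidirect_tau3 {s ε : k} (hs : s ^ 2 = 3) (h1 : lam = 1 + s)
    (hε : IsPrimitiveRoot ε 3) (hl : lam ^ 3 ≠ 1) (ha : a ≠ 0) (hc : c ≠ 0)
    (he : a ^ 3 + a ^ 3 + c ^ 3 = 3 * lam * a * a * c) (hca : c = lam * a) :
    PAutEqSemidirect (potential a a c) lam (heisPerm lam)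
      (Subgroup.zpowers (tau3 hs h1 hε)) := by
  have s0 : s ≠ 0 := by rintro rfl; norm_num at hs
  refine pautEqSemidirect_of_forall hε ha ha hc he (induces_tau3 hs h1 hε)
    (isSemidirect_tau3 hs h1 hε) (mul_ne_zero three_ne_zero s0)
    (hca ▸ scales_lin3 hs h1 hε) ?_
  have swap : ∀ g : V3 k ≃ₗ[k] V3 k, IsHeis (g * lin1 k) → IsHeis (g * lin3 hε ^ 2) := by
    intro g hg
    refine hg.of_smul (κ := 3) three_ne_zero fun v => ?_
    rw [pow_two, LinearEquiv.mul_apply, LinearEquiv.mul_apply, lin3_lin3, map_smul]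
    rfl
  intro g μ hμ h
  -- Since `lin1` is `lin3 ^ 2` up to a scalar, the four cases are the exponents 0, 2, 1, 3 of
  -- `lin3`.
  rcases h.isHeisSwap_or_lin3 hμ hl ha hc he hs h1 hε with (h2 | h2) | (h2 | h2)
  · exact ⟨0, by rwa [pow_zero, mul_one]⟩
  · exact ⟨2, swap _ h2⟩
  · exact ⟨1, by rwa [pow_one]⟩
  · exact ⟨3, by rw [pow_succ', ← mul_assoc]; exact swap _ h2⟩

end

end Sklyanin

end

open Sklyanin
theorem proposition4 {k : Type*} [Field k] [IsAlgClosed k] [CharZero k]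
    (lam : k) (hlam : lam ^ 3 ≠ 1)
    (p : HesseCurve lam) (hp : p ∉ torsion lam 3)
    (a b c : k) (habc : ![a, b, c] ≠ 0) (hpabc : p.1 = Projectivization.mk k ![a, b, c] habc) :
    ∃ T : Subgroup (Equiv.Perm (HesseCurve lam)),
      IsTranslationGroup lam 3 T ∧
      -- the case `j(E) ≠ 0, 12³`
      (jInv lam ≠ 0 → jInv lam ≠ 12 ^ 3 →
        (p ∉ torsion lam 2 → PAutEq (potential a b c) lam T) ∧
        (p ∈ torsion lam 2 → PAutEqSemidirect (potential a b c) lam T (Subgroup.zpowers (tau1 lam)))) ∧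
      -- the case `λ = 0`
      (∀ (h0 : lam = 0) (ε : k) (hε : IsPrimitiveRoot ε 3),
        (p ∉ torsion lam 2 → PAutEq (potential a b c) lam T) ∧
        (p ∈ torsion lam 2 → PAutEqSemidirect (potential a b c) lam T (Subgroup.zpowers (tau2 h0 hε ^ 3)))) ∧
      -- the case `λ = 1 + √3`
      (∀ (s : k) (hs : s ^ 2 = 3) (h1 : lam = 1 + s) (ε : k) (hε : IsPrimitiveRoot ε 3),
        (p ∉ torsion lam 2 → PAutEq (potential a b c) lam T) ∧
        (p ∈ torsion lam 2 \ {0, specialPoint hs h1} →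
          PAutEqSemidirect (potential a b c) lam T (Subgroup.zpowers (tau3 hs h1 hε ^ 2))) ∧
        (p = specialPoint hs h1 →
          PAutEqSemidirect (potential a b c) lam T (Subgroup.zpowers (tau3 hs h1 hε)))) := by
  -- η serves only for the faithfulness of the action and is independent of the ε in the individual
  -- cases.
  obtain ⟨η, hη⟩ := HasEnoughRootsOfUnity.exists_primitiveRoot k 3
  have he : a ^ 3 + b ^ 3 + c ^ 3 = 3 * lam * a * b * c := by
    have := hesseForm_of_eq_mk hpabc
    simp [hesseForm] at this
    linear_combination this
  have habc0 : coordProd ![a, b, c] ≠ 0 := fun h =>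
    hp ((mem_torsion_three hlam p).2 (exists_heis_of_coordProd hpabc h))
  simp only [coordProd, Matrix.cons_val, mul_ne_zero_iff] at habc0
  obtain ⟨⟨ha, hb⟩, hc⟩ := habc0
  have h2 : p ∈ torsion lam 2 ↔ a = b := mem_torsion_two hlam hpabc ha hb hc
  have hT : p ∉ torsion lam 2 → PAutEq (potential a b c) lam (heisPerm lam) := fun h =>
    pautEq_heisPerm hη hlam ha hb hc he (mt h2.2 h)
  refine ⟨heisPerm lam, isTranslationGroup_heisPerm hlam, fun hj0 hj => ⟨hT, fun h => ?_⟩,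
    fun h0 ε hε => ⟨hT, fun h => ?_⟩, fun s hs h1 ε hε => ⟨hT, fun h => ?_, fun h => ?_⟩⟩
  · obtain rfl := h2.1 h
    refine pautEqSemidirect_tau1 hη hlam ha hc he fun hH => hj ?_
    exact jInv_of_hessian hlam (lam_of_hessian hlam ha hc he hH).2
  · obtain rfl := h2.1 h
    rw [tau2_cube]
    exact pautEqSemidirect_tau1 hη hlam ha hc he fun hH =>
      (lam_of_hessian hlam ha hc he hH).1 h0
  · obtain rfl := h2.1 h.1
    rw [tau3_sq]
    refine pautEqSemidirect_tau1 hη hlam ha hc he fun hH => h.2 (Or.inr (Subtype.ext ?_))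
    rw [hpabc, specialPoint, HesseCurve.mk, Projectivization.mk_eq_mk_iff']
    refine ⟨a, ?_⟩
    rw [eq_of_hessian hs h1 hH]
    ext i
    fin_cases i <;> simp [mul_comm]
  · rw [h, specialPoint, HesseCurve.mk, eq_comm, Projectivization.mk_eq_mk_iff'] at hpabc
    obtain ⟨t, ht⟩ := hpabc
    have e0 := congrFun ht 0
    have e1 := congrFun ht 1
    have e2 := congrFun ht 2
    simp at e0 e1 e2
    obtain rfl : a = b := e0.symm.trans e1
    exact pautEqSemidirect_tau3 hs h1 hε hlam ha hc he (by rw [← e2, ← e0, mul_comm])
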